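/- Let $n$ be a dimension and let functions on $\mathbb R^n$ be real- or complex-valued. Write $\ln_+ s=\max(\ln s,0)$ for $s>0$, and $\ln_+0=0$. For a smooth real-valued function $\varphi$ on $\mathbb R^n$ and $t>0$ put $\varphi_t(x)=t^{-n}\varphi(x/t)$, and for $g\in L^1(\mathbb R^n)$ put $\mathcal M_\varphi g(x)=\sup_{t>0}|\varphi_t*g(x)|$. The Hardy space $\mathcal H^1(\mathbb R^n)$ is the space of all $g\in L^1(\mathbb R^n)$ such that $\int_{\mathbb R^n}\mathcal M_\varphi g\,dx<\infty$ for some smooth $\varphi$ supported in the closed unit ball with $\int\varphi\,dx\neq0$. Let $\theta$ be a bounded measurable function on $\mathbb R^n$ supported in the unit cube $(-\frac12,\frac12)^n$ with $\int\theta\,dx=1$, let $f\in L^1(\mathbb R^n)$, and define $$T_\theta f:=f-\Big(\int_{\mathbb R^n} f\,dx\Big)\theta .$$ (1) If $$\int_{\mathbb R^n}|f(x)|\,\bigl(1+\ln_+|f(x)|+\ln_+|x|\bigr)\,dx<\infty,\qquad(*)$$ then $T_\theta f\in\mathcal H^1(\mathbb R^n)$. (2) Conversely, if $f\ge 0$ almost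 everywhere and $T_\theta f\in\mathcal H^1(\mathbb R^n)$, then $(*)$ holds. -/

import Mathlib

open MeasureTheory

/-- The open unit cube `(-1/2, 1/2)^n`. -/
def unitCube (n : ℕ) : Set (EuclideanSpace ℝ (Fin n)) :=
  {x | ∀ i, x i ∈ Set.Ioo (-(1 / 2) : ℝ) (1 / 2)}

/-- The dilation `φ_t(x) = t⁻ⁿ φ(t⁻¹ x)`. -/
noncomputable def dilation {n : ℕ} (φ : EuclideanSpace ℝ (Fin n) → ℝ) (t : ℝ)
    (x : EuclideanSpace ℝ (Fin n)) : ℝ :=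
  (t ^ n)⁻¹ * φ (t⁻¹ • x)

/-- The maximal function `M_φ g(x) = sup_{t > 0} |φ_t * g (x)|`, with values in `[0, ∞]`. -/
noncomputable def smoothMaximal {𝕜 : Type*} [RCLike 𝕜] {n : ℕ}
    (φ : EuclideanSpace ℝ (Fin n) → ℝ) (g : EuclideanSpace ℝ (Fin n) → 𝕜)
    (x : EuclideanSpace ℝ (Fin n)) : ENNReal :=
  ⨆ (t : ℝ) (_ : 0 < t), ‖∫ y, dilation φ t (x - y) • g y‖ₑ

/-- `g` belongs to the Hardy space `H¹(ℝⁿ)`: it is integrable and, for some smooth `φ` supported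
in the unit ball with nonzero integral, its maximal function `M_φ g` has finite integral. -/
def MemHardyH1 {𝕜 : Type*} [RCLike 𝕜] {n : ℕ} (g : EuclideanSpace ℝ (Fin n) → 𝕜) : Prop :=
  Integrable g volume ∧
    ∃ φ : EuclideanSpace ℝ (Fin n) → ℝ,
      ContDiff ℝ ((⊤ : ℕ∞) : WithTop ℕ∞) φ ∧
      tsupport φ ⊆ Metric.closedBall 0 1 ∧
      (∫ y, φ y) ≠ 0 ∧
      (∫⁻ x, smoothMaximal φ g x) < ⊤

/-- `T_θ f = f - (∫ f) θ`. -/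
noncomputable def cancelMean {𝕜 : Type*} [RCLike 𝕜] {n : ℕ}
    (θ f : EuclideanSpace ℝ (Fin n) → 𝕜) (x : EuclideanSpace ℝ (Fin n)) : 𝕜 :=
  f x - (∫ y, f y) * θ x

/-!
Write `g = T_θ f`, so that `∫ g = 0`, and let `N a` be the number of `k : ℕ` with `2 ^ k < a`
(`dyadicCount`), which is comparable to `log⁺ a`. All logarithms below arise as such counts.

*Sufficiency.* Let `φ` be a bump function. For `t ≤ (1 + |x|) / 10` the number `|φ_t * g (x)|` is at
most a local maximal function of `|g|`. With the integrable weight `w(x) = (1 + |x|) ^ (-(n + 1))`,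
nearly constant on the balls in question, Vitali's lemma gives a weak-type estimate with respect to
`w dx` (`withDensity_localLargeSet_le`); summing it over the levels `2 ^ k` bounds the integral of
the local maximal function by `∫ w + C ∫ |g| N(|g| / (c w))`, which the hypothesis controls
(`lintegral_localMaximal_lt_top`). Measuring `|g|` against `w` treats the local and the global
logarithm at once. For larger `t` the cancellation of `g` gives the bound
`C 2 ^ (-k n) ∫ min(1, |y| / 2 ^ k) |g y| dy` where `1 + |x| ∼ 2 ^ k`, and integration in `x` leaves
`∑ min(1, |y| / 2 ^ k) ≤ N |y| + 2`.

*Necessity.* Here `φ` is given and may change sign, so that `φ_t * f` need not be comparable to a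
mean of `f ≥ 0`, and two arguments replace the comparison of maximal functions.

For `∫ f log⁺ f`, take for almost every point of `{f > s}` an almost maximal ball `B(x, t)` on which
`f` has mean larger than `s`. On concentric balls of at least twice the radius the mean is at
most `s`; hence testing `φ_τ * f`, with `τ` a small multiple of `t`, against a tent over
`B(x, 2 t)` gives at least `c s |B(x, t)|`, while `|φ_τ * f| ≤ C s` there. So
`|φ_τ * f| > c s` on a fixed proportion of the ball (`exists_forall_le_volume_convolution_gt`).
Vitali's lemma gives `∫_{f > s} f ≤ C s |{M_φ g > c s}|` for `s` so large that the bounded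
contribution of `θ` is negligible (`exists_forall_setLIntegral_gt_le`), and one sums over `s = 2 ^ k s₀`.

For `∫ f log⁺ |x|`, let `Ψ(y)` be the integral of `φ(x - y)` over a small ball of points `x` away
from `0`, chosen such that `Ψ(0) ≠ 0`. The dilates of that ball by `2 ^ k` are disjoint, so
`∑_k |∫ g(y) Ψ(y / 2 ^ k) dy| ≤ ∫ M_φ g`. As `∫ g = 0`, and `1 - Ψ(y / 2 ^ k) / Ψ(0)` is of
order `2 ^ (-k)` on the support of `θ`, this bounds `∫ f(y) ∑_k (1 - Ψ(y / 2 ^ k) / Ψ(0)) dy`, where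
the sum of the first `K` terms is `min(K, log₂⁺ |y|) + O(1)` (`lintegral_mul_dyadicCount_lt_top`).
-/

open scoped ENNReal NNReal

/-! ### Counting powers of two -/

/-- The number of exponents `k : ℕ` with `2 ^ k < a`, as an extended nonnegative number. -/
noncomputable def dyadicCount (a : ℝ) : ℝ≥0∞ :=
  ∑' k : ℕ, if (2 : ℝ) ^ k < a then 1 else 0

lemma exists_pow_two_lt_le {a : ℝ} (ha : 1 < a) :
    ∃ K : ℕ, (2 : ℝ) ^ K < a ∧ a ≤ 2 ^ (K + 1) ∧
      ∀ k : ℕ, (2 : ℝ) ^ k < a ↔ k ∈ Finset.range (K + 1) := by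
  obtain ⟨K, h1, h2⟩ : ∃ K : ℕ, (2 : ℝ) ^ K < a ∧ a ≤ 2 ^ (K + 1) := by
    have hex : ∃ m : ℕ, a ≤ (2 : ℝ) ^ m :=
      (pow_unbounded_of_one_lt a (by norm_num : (1 : ℝ) < 2)).imp fun _ h => h.le
    classical
    have hpos : Nat.find hex ≠ 0 := by
      intro h0
      have := Nat.find_spec hex
      rw [h0] at this
      norm_num at this
      linarith
    obtain ⟨K, hK⟩ := Nat.exists_eq_succ_of_ne_zero hpos
    refine ⟨K, ?_, ?_⟩
    · have := Nat.find_min hex (m := K) (by omega)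
      exact not_le.1 this
    · have := Nat.find_spec hex
      rwa [hK] at this
  refine ⟨K, h1, h2, fun k => ?_⟩
  rw [Finset.mem_range]
  constructor
  · intro hk
    by_contra hcon
    have : (2 : ℝ) ^ (K + 1) ≤ 2 ^ k := pow_le_pow_right₀ (by norm_num) (by omega)
    linarith
  · intro hk
    have : (2 : ℝ) ^ k ≤ 2 ^ K := pow_le_pow_right₀ (by norm_num) (by omega)
    linarith

lemma not_pow_two_lt {a : ℝ} (ha : a ≤ 1) (k : ℕ) : ¬ (2 : ℝ) ^ k < a :=
  not_lt.2 (ha.trans (one_le_pow₀ (by norm_num)))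

lemma dyadicCount_of_le_one {a : ℝ} (ha : a ≤ 1) : dyadicCount a = 0 := by
  simp [dyadicCount, not_pow_two_lt ha]

lemma dyadicCount_eq {a : ℝ} {K : ℕ}
    (hK : ∀ k : ℕ, (2 : ℝ) ^ k < a ↔ k ∈ Finset.range (K + 1)) :
    dyadicCount a = (K + 1 : ℕ) := by
  simp only [dyadicCount, hK]
  rw [tsum_eq_sum (s := Finset.range (K + 1)) (by intro b hb; simp [hb])]
  rw [Finset.sum_congr rfl (fun k hk => if_pos hk)]
  simp

lemma dyadicCount_le (a : ℝ) (ha : 0 ≤ a) :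
    dyadicCount a ≤ ENNReal.ofReal (1 + 2 * Real.posLog a) := by
  rcases le_or_gt a 1 with h | h
  · simp [dyadicCount_of_le_one h]
  · obtain ⟨K, h1, -, h3⟩ := exists_pow_two_lt_le h
    rw [dyadicCount_eq h3, ← ENNReal.ofReal_natCast]
    apply ENNReal.ofReal_le_ofReal
    have hlog : (K : ℝ) * Real.log 2 ≤ Real.log a := by
      rw [← Real.log_pow]
      exact Real.log_le_log (by positivity) h1.le
    rw [Real.posLog_eq_log (by rw [abs_of_nonneg ha]; exact h.le)]
    have := Real.log_two_gt_d9
    have hK : (0 : ℝ) ≤ K := by positivity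
    push_cast
    nlinarith

lemma ofReal_posLog_le_dyadicCount (a : ℝ) (ha : 0 ≤ a) :
    ENNReal.ofReal (Real.posLog a) ≤ dyadicCount a := by
  rcases le_or_gt a 1 with h | h
  · rw [Real.posLog_eq_zero_iff _ |>.2 (by rwa [abs_of_nonneg ha])]
    simp
  · obtain ⟨K, -, h2, h3⟩ := exists_pow_two_lt_le h
    rw [dyadicCount_eq h3, ← ENNReal.ofReal_natCast]
    apply ENNReal.ofReal_le_ofReal
    have hlog : Real.log a ≤ ((K + 1 : ℕ) : ℝ) * Real.log 2 := by
      rw [← Real.log_pow]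
      exact Real.log_le_log (by linarith) h2
    rw [Real.posLog_eq_log (by rw [abs_of_nonneg ha]; exact h.le)]
    have := Real.log_two_lt_d9
    have hK : (0 : ℝ) ≤ (K + 1 : ℕ) := by positivity
    nlinarith

lemma tsum_pow_two_lt_le (a : ℝ≥0∞) :
    ∑' k : ℕ, (if ENNReal.ofReal (2 ^ k) < a then ENNReal.ofReal (2 ^ k) else 0) ≤ 2 * a := by
  rcases eq_or_ne a ⊤ with rfl | hfin
  · simp
  lift a to ℝ≥0 using hfin
  have hiff : ∀ k : ℕ, ENNReal.ofReal (2 ^ k) < (a : ℝ≥0∞) ↔ (2 : ℝ) ^ k < a := fun k => by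
    rw [← ENNReal.ofReal_coe_nnreal, ENNReal.ofReal_lt_ofReal_iff_of_nonneg (by positivity)]
  simp only [hiff]
  rcases le_or_gt (a : ℝ) 1 with h | h
  · simp [not_pow_two_lt h]
  · obtain ⟨K, h1, -, h3⟩ := exists_pow_two_lt_le h
    simp only [h3]
    rw [tsum_eq_sum (s := Finset.range (K + 1)) (by intro b hb; simp [hb])]
    rw [Finset.sum_congr rfl (fun k hk => if_pos hk),
      ← ENNReal.ofReal_sum_of_nonneg (fun _ _ => by positivity), geom_sum_eq (by norm_num)]
    rw [← ENNReal.ofReal_coe_nnreal, show (2 : ℝ≥0∞) = ENNReal.ofReal 2 by simp,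
      ← ENNReal.ofReal_mul (by norm_num)]
    apply ENNReal.ofReal_le_ofReal
    rw [pow_succ]
    norm_num
    linarith

lemma le_one_add_tsum_pow_two_lt (a : ℝ≥0∞) :
    a ≤ 1 + ∑' k : ℕ, (if ENNReal.ofReal (2 ^ k) < a then ENNReal.ofReal (2 ^ (k + 1)) else 0) := by
  rcases eq_or_ne a ⊤ with rfl | hfin
  · have : (∑' k : ℕ, (if ENNReal.ofReal (2 ^ k) < ⊤ then ENNReal.ofReal (2 ^ (k + 1)) else 0))
        = ⊤ := by
      refine top_le_iff.1 ?_
      refine (ENNReal.tsum_const_eq_top_of_ne_zero (α := ℕ) (c := 1) (by simp)).ge.trans ?_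
      refine ENNReal.tsum_le_tsum fun k => ?_
      rw [if_pos ENNReal.ofReal_lt_top]
      rw [← ENNReal.ofReal_one]
      exact ENNReal.ofReal_le_ofReal (one_le_pow₀ (by norm_num))
    simp only [this, add_top, le_refl]
  lift a to ℝ≥0 using hfin
  rcases le_or_gt (a : ℝ) 1 with h | h
  · refine le_add_right ?_
    exact_mod_cast h
  · obtain ⟨K, h1, h2, -⟩ := exists_pow_two_lt_le h
    refine le_trans ?_ (le_add_left (ENNReal.le_tsum K))
    rw [if_pos, ← ENNReal.ofReal_coe_nnreal]
    · exact ENNReal.ofReal_le_ofReal h2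
    · rw [← ENNReal.ofReal_coe_nnreal, ENNReal.ofReal_lt_ofReal_iff_of_nonneg (by positivity)]
      exact h1

/-- Dividing a number by the powers of two above it gives a geometric series. -/
lemma tsum_div_pow_two_le_two (a : ℝ) :
    ∑' k : ℕ, ENNReal.ofReal (if a ≤ 2 ^ k then a / 2 ^ k else 0) ≤ 2 := by
  have hgeom : ∑' k : ℕ, ENNReal.ofReal ((1 / 2 : ℝ) ^ k) = 2 := by
    rw [← ENNReal.ofReal_tsum_of_nonneg (fun k => by positivity)
      (summable_geometric_of_lt_one (by norm_num) (by norm_num)),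
      tsum_geometric_of_lt_one (by norm_num) (by norm_num)]
    norm_num
  rcases le_or_gt a 1 with h | h
  · rw [← hgeom]
    refine ENNReal.tsum_le_tsum fun k => ENNReal.ofReal_le_ofReal ?_
    rw [if_pos (not_lt.1 (not_pow_two_lt h k)), one_div, inv_pow, div_eq_mul_inv]
    exact mul_le_of_le_one_left (by positivity) h
  · obtain ⟨K, h1, h2, h3⟩ := exists_pow_two_lt_le h
    rw [← Summable.sum_add_tsum_nat_add' (k := K + 1) ENNReal.summable, Finset.sum_eq_zero,
      zero_add, ← hgeom]
    · refine ENNReal.tsum_le_tsum fun k => ENNReal.ofReal_le_ofReal ?_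
      have h4 : a ≤ 2 ^ (k + (K + 1)) :=
        h2.trans (pow_le_pow_right₀ (by norm_num) (by omega))
      rw [if_pos h4, div_le_iff₀ (by positivity), pow_add, ← mul_assoc, ← mul_pow]
      norm_num
      exact h2
    · intro k hk
      rw [if_neg (not_le.2 ((h3 k).2 hk)), ENNReal.ofReal_zero]

/-- Terms with `2 ^ k < a` are counted by `dyadicCount a`, the others form a geometric series. -/
lemma tsum_min_one_div_pow_two_le (a : ℝ) :
    ∑' k : ℕ, ENNReal.ofReal (min 1 (a / 2 ^ k)) ≤ dyadicCount a + 2 := by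
  refine le_trans ?_ (add_le_add_right (tsum_div_pow_two_le_two a) _)
  rw [dyadicCount, ← ENNReal.tsum_add]
  refine ENNReal.tsum_le_tsum fun k => ?_
  by_cases h : (2 : ℝ) ^ k < a
  · rw [if_pos h, if_neg (not_le.2 h), ENNReal.ofReal_zero, add_zero, ← ENNReal.ofReal_one]
    exact ENNReal.ofReal_le_ofReal (min_le_left _ _)
  · rw [if_neg h, if_pos (not_lt.1 h), zero_add]
    exact ENNReal.ofReal_le_ofReal (min_le_right _ _)

lemma sum_range_div_pow_two_le_two {a : ℝ} (ha : 0 ≤ a) (m : ℕ) :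
    ∑ k ∈ Finset.range m, (if a ≤ 2 ^ k then a / 2 ^ k else 0) ≤ 2 := by
  have h := (ENNReal.sum_le_tsum (Finset.range m)).trans (tsum_div_pow_two_le_two a)
  rw [← ENNReal.ofReal_sum_of_nonneg fun k _ => by split_ifs <;> positivity] at h
  rwa [← ENNReal.ofReal_ofNat 2, ENNReal.ofReal_le_ofReal_iff (by norm_num)] at h

/-! ### Vitali covering and the weighted weak-type estimate -/

/-- Vitali's covering lemma as a comparison of measures: an estimate of `ν` on the fivefold
enlargements of balls centred at the points of `S` by `ρ` on the balls themselves bounds `ν S` by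
the total mass of `ρ`. -/
lemma measure_le_of_forall_closedBall_le {E : Type*} [NormedAddCommGroup E] [NormedSpace ℝ E]
    [SecondCountableTopology E] [MeasurableSpace E] [BorelSpace E] (ν ρ : Measure E)
    (S : Set E) (r : E → ℝ) (R : ℝ) (hr : ∀ x ∈ S, 0 < r x) (hR : ∀ x ∈ S, r x ≤ R) (C : ℝ≥0∞)
    (hC : ∀ x ∈ S, ν (Metric.closedBall x (5 * r x)) ≤ C * ρ (Metric.closedBall x (r x))) :
    ν S ≤ C * ρ Set.univ := by
  obtain ⟨u, huS, hdisj, hcov⟩ :=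
    Vitali.exists_disjoint_subfamily_covering_enlargement_closedBall S id r R hR 5 (by norm_num)
  simp only [id] at hdisj hcov
  have hcount : u.Countable := by
    refine hdisj.countable_of_nonempty_interior fun x hx => ?_
    exact ⟨x, Metric.ball_subset_interior_closedBall (Metric.mem_ball_self (hr x (huS hx)))⟩
  have hsub : S ⊆ ⋃ x ∈ u, Metric.closedBall x (5 * r x) := by
    intro x hx
    obtain ⟨b, hb, hb'⟩ := hcov x hx
    exact Set.mem_biUnion hb (hb' (Metric.mem_closedBall_self (hr x hx).le))
  calc ν S ≤ ν (⋃ x ∈ u, Metric.closedBall x (5 * r x)) := measure_mono hsub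
    _ ≤ ∑' x : u, ν (Metric.closedBall (x : E) (5 * r x)) := measure_biUnion_le ν hcount _
    _ ≤ ∑' x : u, C * ρ (Metric.closedBall (x : E) (r x)) :=
        ENNReal.tsum_le_tsum fun x => hC x (huS x.2)
    _ = C * ρ (⋃ x ∈ u, Metric.closedBall x (r x)) := by
        rw [ENNReal.tsum_mul_left,
          measure_biUnion hcount hdisj fun x _ => Metric.isClosed_closedBall.measurableSet]
    _ ≤ C * ρ Set.univ := by gcongr; exact Set.subset_univ _

/-- The Lebesgue measure of the unit ball. -/
noncomputable def unitBallVolume (n : ℕ) : ℝ :=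
  volume.real (Metric.ball (0 : EuclideanSpace ℝ (Fin n)) 1)

lemma unitBallVolume_pos (n : ℕ) : 0 < unitBallVolume n :=
  ENNReal.toReal_pos (Metric.measure_ball_pos volume _ one_pos).ne' measure_ball_lt_top.ne

lemma volume_closedBall_eq {n : ℕ} (x : EuclideanSpace ℝ (Fin n)) {r : ℝ} (hr : 0 ≤ r) :
    volume (Metric.closedBall x r) = ENNReal.ofReal (r ^ n * unitBallVolume n) := by
  rw [Measure.addHaar_closedBall volume x hr, ENNReal.ofReal_mul (by positivity), unitBallVolume,
    ofReal_measureReal measure_ball_lt_top.ne, finrank_euclideanSpace, Fintype.card_fin]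

/-- The integrable weight `(1 + |x|) ^ (-(n + 1))`; it is comparable to a constant on every ball
`B(x, (1 + |x|) / 2)`. -/
noncomputable def decayWeight {n : ℕ} (x : EuclideanSpace ℝ (Fin n)) : ℝ :=
  ((1 + ‖x‖) ^ (n + 1))⁻¹

lemma decayWeight_pos {n : ℕ} (x : EuclideanSpace ℝ (Fin n)) : 0 < decayWeight x := by
  unfold decayWeight; positivity

@[fun_prop]
lemma continuous_decayWeight {n : ℕ} :
    Continuous (decayWeight : EuclideanSpace ℝ (Fin n) → ℝ) := by
  unfold decayWeight
  refine Continuous.inv₀ (by fun_prop) fun x => by positivity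

lemma lintegral_decayWeight_lt_top (n : ℕ) :
    ∫⁻ x : EuclideanSpace ℝ (Fin n), ENNReal.ofReal (decayWeight x) < ⊤ := by
  have := finite_integral_one_add_norm (E := EuclideanSpace ℝ (Fin n)) (μ := volume)
    (r := (n + 1 : ℕ)) (by simp)
  refine lt_of_eq_of_lt (lintegral_congr fun x => ?_) this
  rw [decayWeight, Real.rpow_neg (by positivity), Real.rpow_natCast]

lemma decayWeight_le {n : ℕ} {x y : EuclideanSpace ℝ (Fin n)} (h : dist y x ≤ (1 + ‖x‖) / 2) :
    decayWeight y ≤ 2 ^ (n + 1) * decayWeight x := by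
  have h1 : (1 + ‖x‖) / 2 ≤ 1 + ‖y‖ := by
    have := norm_sub_norm_le x y
    rw [← dist_eq_norm, dist_comm] at this
    linarith [norm_nonneg y]
  calc decayWeight y ≤ (((1 + ‖x‖) / 2) ^ (n + 1))⁻¹ := by unfold decayWeight; gcongr
    _ = _ := by rw [div_pow, inv_div, decayWeight]; rfl

lemma setLIntegral_decayWeight_le {n : ℕ} {x : EuclideanSpace ℝ (Fin n)} {r : ℝ} (hr : 0 ≤ r)
    (h : r ≤ (1 + ‖x‖) / 2) {a : ℝ} (ha : 0 ≤ a) :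
    ∫⁻ y in Metric.closedBall x r, ENNReal.ofReal (a * decayWeight y) ≤
      ENNReal.ofReal (a * (2 ^ (n + 1) * decayWeight x) * (r ^ n * unitBallVolume n)) := by
  have := decayWeight_pos x
  rw [ENNReal.ofReal_mul (by positivity), ← volume_closedBall_eq x hr, ← setLIntegral_const]
  refine setLIntegral_mono measurable_const fun y hy => ENNReal.ofReal_le_ofReal ?_
  gcongr
  exact decayWeight_le ((Metric.mem_closedBall.1 hy).trans h)

/-- The points `x` at which some ball of radius `t ≤ (1 + |x|) / 10` carries a mean of `h` (up to
the constant `unitBallVolume n`) larger than `s * decayWeight x`. -/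
def localLargeSet {n : ℕ} (h : EuclideanSpace ℝ (Fin n) → ℝ) (s : ℝ) :
    Set (EuclideanSpace ℝ (Fin n)) :=
  {x | ∃ t : ℝ, 0 < t ∧ t ≤ (1 + ‖x‖) / 10 ∧
    ENNReal.ofReal (s * decayWeight x * t ^ n) <
      ∫⁻ y in Metric.closedBall x t, ENNReal.ofReal (h y)}

/-- The constant `κ` such that on a ball centred at `x` of the radii in `localLargeSet`, the function
`κ s * decayWeight` has at most half of the mass `s * decayWeight x * t ^ n`. -/
noncomputable def weakThreshold (n : ℕ) : ℝ := (2 * 2 ^ (n + 1) * unitBallVolume n)⁻¹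

lemma weakThreshold_pos (n : ℕ) : 0 < weakThreshold n := by
  have := unitBallVolume_pos n
  unfold weakThreshold; positivity

/-- Weighted weak-type estimate for the local maximal function. -/
lemma withDensity_localLargeSet_le {n : ℕ} (h : EuclideanSpace ℝ (Fin n) → ℝ)
    {s : ℝ} (hs : 0 < s) :
    (volume.withDensity fun x => ENNReal.ofReal (decayWeight x)) (localLargeSet h s) ≤
      ENNReal.ofReal (2 ^ (n + 2) * 5 ^ n * unitBallVolume n / s) *
        ∫⁻ y, Set.indicator {y | weakThreshold n * s * decayWeight y < h y}
          (fun y => ENNReal.ofReal (h y)) y := by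
  set ν := volume.withDensity fun x : EuclideanSpace ℝ (Fin n) => ENNReal.ofReal (decayWeight x)
  set H := Set.indicator {y | weakThreshold n * s * decayWeight y < h y}
          (fun y => ENNReal.ofReal (h y)) with hH
  have hv := unitBallVolume_pos n
  -- Vitali's lemma needs bounded radii, so the set is exhausted by its parts with radii at most `N`.
  set S : ℕ → Set (EuclideanSpace ℝ (Fin n)) := fun N => {x | ∃ t : ℝ, 0 < t ∧
    t ≤ (1 + ‖x‖) / 10 ∧ ENNReal.ofReal (s * decayWeight x * t ^ n) <
      ∫⁻ y in Metric.closedBall x t, ENNReal.ofReal (h y) ∧ t ≤ N} with hS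
  have hmono : Monotone S := by
    rintro N M hNM x ⟨t, h1, h2, h3, h4⟩
    exact ⟨t, h1, h2, h3, h4.trans (by exact_mod_cast hNM)⟩
  have hunion : localLargeSet h s = ⋃ N, S N := by
    ext x
    rw [Set.mem_iUnion]
    constructor
    · rintro ⟨t, h1, h2, h3⟩
      obtain ⟨N, hN⟩ := exists_nat_ge t
      exact ⟨N, t, h1, h2, h3, hN⟩
    · rintro ⟨N, t, h1, h2, h3, -⟩
      exact ⟨t, h1, h2, h3⟩
  rw [hunion, hmono.measure_iUnion]
  refine iSup_le fun N => ?_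
  have hch : ∀ x, ∃ t : ℝ, x ∈ S N → 0 < t ∧
    t ≤ (1 + ‖x‖) / 10 ∧ ENNReal.ofReal (s * decayWeight x * t ^ n) <
      ∫⁻ y in Metric.closedBall x t, ENNReal.ofReal (h y) ∧ t ≤ N := by
    intro x
    by_cases hx : x ∈ S N
    · obtain ⟨t, ht⟩ := hx
      exact ⟨t, fun _ => ht⟩
    · exact ⟨0, fun h => absurd h hx⟩
  choose r hr using hch
  have key := measure_le_of_forall_closedBall_le ν (volume.withDensity H) (S N) r N
    (fun x hx => (hr x hx).1) (fun x hx => (hr x hx).2.2.2)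
    (ENNReal.ofReal (2 ^ (n + 2) * 5 ^ n * unitBallVolume n / s)) ?_
  · rwa [withDensity_apply _ MeasurableSet.univ, Measure.restrict_univ] at key
  intro x hx
  obtain ⟨h1, h2, h3, -⟩ := hr x hx
  have hw := decayWeight_pos x
  rw [withDensity_apply _ Metric.isClosed_closedBall.measurableSet,
    withDensity_apply _ Metric.isClosed_closedBall.measurableSet]
  -- at least half of the mass on the ball comes from the points above the threshold
  have hlow : ENNReal.ofReal (s * decayWeight x * r x ^ n / 2) ≤
      ∫⁻ y in Metric.closedBall x (r x), H y := by
    have hsplit : ∫⁻ y in Metric.closedBall x (r x), ENNReal.ofReal (h y) ≤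
        ENNReal.ofReal (s * decayWeight x * r x ^ n / 2) +
          ∫⁻ y in Metric.closedBall x (r x), H y := by
      calc _ ≤ ∫⁻ y in Metric.closedBall x (r x),
            (ENNReal.ofReal (weakThreshold n * s * decayWeight y) + H y) := by
              refine lintegral_mono fun y => ?_
              by_cases hy : weakThreshold n * s * decayWeight y < h y
              · refine le_add_left ?_
                rw [hH, Set.indicator_of_mem (by exact hy)]
              · exact le_add_right (ENNReal.ofReal_le_ofReal (not_lt.1 hy))
        _ = _ := lintegral_add_left
              (ENNReal.measurable_ofReal.comp (by fun_prop)) _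
        _ ≤ _ := by
              gcongr
              refine (setLIntegral_decayWeight_le h1.le (h2.trans ?_)
                (mul_pos (weakThreshold_pos n) hs).le).trans (ENNReal.ofReal_le_ofReal (le_of_eq ?_))
              · have := norm_nonneg x
                linarith
              · rw [weakThreshold]; field_simp
    have h4 := h3.trans_le hsplit
    rw [show s * decayWeight x * r x ^ n =
      s * decayWeight x * r x ^ n / 2 + s * decayWeight x * r x ^ n / 2 by ring,
      ENNReal.ofReal_add (by positivity) (by positivity)] at h4
    rw [show (s * decayWeight x * r x ^ n / 2 + s * decayWeight x * r x ^ n / 2) / 2 =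
      s * decayWeight x * r x ^ n / 2 by ring] at h4
    exact (lt_of_add_lt_add_left h4).le
  calc _ = ∫⁻ y in Metric.closedBall x (5 * r x), ENNReal.ofReal (1 * decayWeight y) := by
        simp
    _ ≤ _ := setLIntegral_decayWeight_le (by positivity) (by linarith) zero_le_one
    _ = ENNReal.ofReal (2 ^ (n + 2) * 5 ^ n * unitBallVolume n / s) *
        ENNReal.ofReal (s * decayWeight x * r x ^ n / 2) := by
        rw [← ENNReal.ofReal_mul (by positivity)]
        congr 1
        field_simp
        ring
    _ ≤ _ := by gcongr

/-! ### The local maximal function -/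

/-- The local maximal function: means (up to the constant `unitBallVolume n`) over balls `B(x, t)`
with `t ≤ (1 + |x|) / 10`. -/
noncomputable def localMaximal {n : ℕ} (h : EuclideanSpace ℝ (Fin n) → ℝ)
    (x : EuclideanSpace ℝ (Fin n)) : ℝ≥0∞ :=
  ⨆ (t : ℝ) (_ : 0 < t) (_ : t ≤ (1 + ‖x‖) / 10),
    ENNReal.ofReal (t ^ n)⁻¹ * ∫⁻ y in Metric.closedBall x t, ENNReal.ofReal (h y)

/-- The local maximal function is bounded by the weight times a sum over dyadic levels. -/
lemma localMaximal_le {n : ℕ} (h : EuclideanSpace ℝ (Fin n) → ℝ)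
    (x : EuclideanSpace ℝ (Fin n)) {T : ℕ → Set (EuclideanSpace ℝ (Fin n))}
    (hT : ∀ k, localLargeSet h (2 ^ k) ⊆ T k) :
    localMaximal h x ≤ ENNReal.ofReal (decayWeight x) *
      (1 + ∑' k : ℕ, (T k).indicator (fun _ => ENNReal.ofReal (2 ^ (k + 1))) x) := by
  have hw := decayWeight_pos x
  have hw' : ENNReal.ofReal (decayWeight x) ≠ 0 := (ENNReal.ofReal_pos.2 hw).ne'
  rw [← ENNReal.mul_div_cancel (b := localMaximal h x) hw' ENNReal.ofReal_ne_top]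
  gcongr
  refine (le_one_add_tsum_pow_two_lt _).trans ?_
  gcongr with k
  split_ifs with hk
  swap
  · exact zero_le
  rw [Set.indicator_of_mem]
  apply hT
  rw [ENNReal.lt_div_iff_mul_lt (Or.inl hw') (Or.inl ENNReal.ofReal_ne_top),
    ← ENNReal.ofReal_mul (by positivity)] at hk
  simp only [localMaximal, lt_iSup_iff] at hk
  obtain ⟨t, ht, ht', hk⟩ := hk
  refine ⟨t, ht, ht', ?_⟩
  have htn : 0 < t ^ n := by positivity
  rw [ENNReal.ofReal_inv_of_pos htn, mul_comm (ENNReal.ofReal (t ^ n))⁻¹, ← div_eq_mul_inv,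
    ENNReal.lt_div_iff_mul_lt (Or.inl (ENNReal.ofReal_pos.2 htn).ne') (Or.inl ENNReal.ofReal_ne_top),
    ← ENNReal.ofReal_mul (by positivity)] at hk
  exact hk

lemma tsum_indicator_pow_two_lt {n : ℕ} {h : EuclideanSpace ℝ (Fin n) → ℝ}
    {y : EuclideanSpace ℝ (Fin n)} {a : ℝ} (ha : 0 < a) :
    ∑' k : ℕ, Set.indicator {y | a * 2 ^ k * decayWeight y < h y}
      (fun y => ENNReal.ofReal (h y)) y =
    ENNReal.ofReal (h y) * dyadicCount (h y / (a * decayWeight y)) := by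
  have hw := decayWeight_pos y
  rw [dyadicCount, ← ENNReal.tsum_mul_left]
  refine tsum_congr fun k => ?_
  have : (2 : ℝ) ^ k < h y / (a * decayWeight y) ↔ a * 2 ^ k * decayWeight y < h y := by
    rw [lt_div_iff₀ (by positivity)]
    ring_nf
  simp only [Set.indicator, Set.mem_ofPred_eq, this]
  split_ifs <;> simp

lemma lintegral_localMaximal_le {n : ℕ} {h : EuclideanSpace ℝ (Fin n) → ℝ}
    (hm : AEMeasurable h) :
    ∫⁻ x, localMaximal h x ≤ (∫⁻ x, ENNReal.ofReal (decayWeight (n := n) x)) +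
      ENNReal.ofReal (2 * (2 ^ (n + 2) * 5 ^ n * unitBallVolume n)) *
        ∫⁻ y, ENNReal.ofReal (h y) * dyadicCount (h y / (weakThreshold n * decayWeight y)) := by
  set ν := volume.withDensity fun x : EuclideanSpace ℝ (Fin n) => ENNReal.ofReal (decayWeight x)
    with hν
  have hv := unitBallVolume_pos n
  -- measurable hulls, so that the measurability of the sets themselves is not needed
  set T : ℕ → Set (EuclideanSpace ℝ (Fin n)) := fun k => toMeasurable ν (localLargeSet h (2 ^ k))
  have hTm : ∀ k, MeasurableSet (T k) := fun k => measurableSet_toMeasurable _ _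
  have hwm : Measurable fun x : EuclideanSpace ℝ (Fin n) => ENNReal.ofReal (decayWeight x) :=
    ENNReal.measurable_ofReal.comp (by fun_prop)
  have hind : ∀ k, Measurable ((T k).indicator fun _ => ENNReal.ofReal (2 ^ (k + 1))) :=
    fun k => measurable_const.indicator (hTm k)
  calc ∫⁻ x, localMaximal h x
      ≤ ∫⁻ x, ENNReal.ofReal (decayWeight x) *
          (1 + ∑' k : ℕ, (T k).indicator (fun _ => ENNReal.ofReal (2 ^ (k + 1))) x) :=
        lintegral_mono fun x => localMaximal_le h x fun k => subset_toMeasurable _ _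
    _ = ∫⁻ x, (1 + ∑' k : ℕ, (T k).indicator (fun _ => ENNReal.ofReal (2 ^ (k + 1))) x) ∂ν := by
        rw [hν]
        exact (lintegral_withDensity_eq_lintegral_mul _ hwm
          (measurable_const.add (Measurable.tsum hind))).symm
    _ = ν Set.univ + ∑' k : ℕ, ENNReal.ofReal (2 ^ (k + 1)) * ν (T k) := by
        rw [lintegral_add_left measurable_const, lintegral_one,
          lintegral_tsum fun k => (hind k).aemeasurable]
        congr 2
        funext k
        exact lintegral_indicator_const (hTm k) _
    _ ≤ ν Set.univ + ∑' k : ℕ, ENNReal.ofReal (2 * (2 ^ (n + 2) * 5 ^ n * unitBallVolume n)) *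
          ∫⁻ y, Set.indicator {y | weakThreshold n * 2 ^ k * decayWeight y < h y}
            (fun y => ENNReal.ofReal (h y)) y := by
        refine add_le_add le_rfl (ENNReal.tsum_le_tsum fun k => ?_)
        rw [measure_toMeasurable]
        refine (mul_le_mul_right (withDensity_localLargeSet_le h (by positivity)) _).trans ?_
        rw [← mul_assoc, ← ENNReal.ofReal_mul (by positivity)]
        refine (congrArg (fun c => ENNReal.ofReal c * _) ?_).le
        field_simp
        ring
    _ = _ := by
        rw [ENNReal.tsum_mul_left, ← lintegral_tsum]
        · congr 2
          · rw [withDensity_apply _ MeasurableSet.univ, Measure.restrict_univ]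
          · congr 1
            funext y
            exact tsum_indicator_pow_two_lt (weakThreshold_pos n)
        · intro k
          refine (ENNReal.measurable_ofReal.comp_aemeasurable hm).indicator₀ ?_
          exact nullMeasurableSet_lt (Continuous.aemeasurable (by fun_prop)) hm

lemma posLog_one_add_le (r : ℝ) : Real.posLog (1 + r) ≤ 1 + Real.posLog r := by
  have h := Real.posLog_add (x := 1) (y := r)
  have := Real.log_two_lt_d9
  rw [Real.posLog_one] at h
  linarith

lemma dyadicCount_div_decayWeight_le (n : ℕ) : ∃ C : ℝ, 0 ≤ C ∧
    ∀ (x : EuclideanSpace ℝ (Fin n)) (a : ℝ), 0 ≤ a →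
      dyadicCount (a / (weakThreshold n * decayWeight x)) ≤
        ENNReal.ofReal (C * (1 + Real.posLog a + Real.posLog ‖x‖)) := by
  set κ := weakThreshold n
  have hκ : 0 < κ := weakThreshold_pos n
  refine ⟨1 + 2 * (Real.posLog κ⁻¹ + (n + 1)) + 2, by positivity [Real.posLog_nonneg (x := κ⁻¹)], ?_⟩
  intro x a ha
  have hw := decayWeight_pos x
  refine (dyadicCount_le _ (by positivity)).trans (ENNReal.ofReal_le_ofReal ?_)
  have e : a / (κ * decayWeight x) = a * (κ⁻¹ * (1 + ‖x‖) ^ (n + 1)) := by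
    rw [decayWeight]; field_simp
  have h1 : Real.posLog (a / (κ * decayWeight x)) ≤
      Real.posLog a + (Real.posLog κ⁻¹ + (n + 1) * (1 + Real.posLog ‖x‖)) := by
    rw [e]
    refine Real.posLog_mul.trans ?_
    gcongr
    refine Real.posLog_mul.trans ?_
    gcongr
    rw [Real.posLog_pow]
    push_cast
    gcongr
    exact posLog_one_add_le ‖x‖
  have p1 := Real.posLog_nonneg (x := a)
  have p2 := Real.posLog_nonneg (x := ‖x‖)
  have p3 := Real.posLog_nonneg (x := κ⁻¹)
  have hn : (0 : ℝ) ≤ n := by positivity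
  have := mul_nonneg p3 p1
  have := mul_nonneg p3 p2
  have := mul_nonneg hn p1
  have := mul_nonneg hn p2
  nlinarith

lemma lintegral_localMaximal_lt_top {n : ℕ} {h : EuclideanSpace ℝ (Fin n) → ℝ}
    (h0 : ∀ x, 0 ≤ h x) (hm : AEMeasurable h)
    (hint : Integrable fun x => h x * (1 + Real.posLog (h x) + Real.posLog ‖x‖)) :
    ∫⁻ x, localMaximal h x < ⊤ := by
  refine (lintegral_localMaximal_le hm).trans_lt ?_
  refine ENNReal.add_lt_top.2 ⟨lintegral_decayWeight_lt_top n,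
    ENNReal.mul_lt_top ENNReal.ofReal_lt_top ?_⟩
  obtain ⟨C, hC0, hC⟩ := dyadicCount_div_decayWeight_le n
  refine lt_of_le_of_lt ?_ (hint.const_mul C).lintegral_lt_top
  refine lintegral_mono fun y => ?_
  refine (mul_le_mul_right (hC y (h y) (h0 y)) _).trans ?_
  rw [← ENNReal.ofReal_mul (h0 y)]
  refine ENNReal.ofReal_le_ofReal (le_of_eq ?_)
  ring

/-! ### Mean-zero functions with logarithmic integrability lie in the Hardy space -/

section dilation
variable {n : ℕ} {φ : EuclideanSpace ℝ (Fin n) → ℝ} {t : ℝ}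

lemma continuous_dilation (hφ : Continuous φ) (t : ℝ) : Continuous (dilation φ t) := by
  unfold dilation; fun_prop

lemma abs_dilation_le {A : ℝ} (hA : ∀ z, |φ z| ≤ A) (ht : 0 < t) (z : EuclideanSpace ℝ (Fin n)) :
    |dilation φ t z| ≤ A * (t ^ n)⁻¹ := by
  rw [dilation, abs_mul, abs_of_pos (by positivity), mul_comm]
  gcongr
  exact hA _

lemma dilation_eq_zero (hs : ∀ z, 1 < ‖z‖ → φ z = 0) (ht : 0 < t)
    {z : EuclideanSpace ℝ (Fin n)} (hz : t < ‖z‖) : dilation φ t z = 0 := by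
  rw [dilation, hs, mul_zero]
  rw [norm_smul, Real.norm_of_nonneg (by positivity), inv_mul_eq_div, one_lt_div ht]
  exact hz

lemma abs_dilation_sub_le {K : ℝ≥0} (hK : LipschitzWith K φ) (ht : 0 < t)
    (z z' : EuclideanSpace ℝ (Fin n)) :
    |dilation φ t z - dilation φ t z'| ≤ (t ^ n)⁻¹ * (K * (‖z - z'‖ / t)) := by
  rw [dilation, dilation, ← mul_sub, abs_mul, abs_of_pos (by positivity : 0 < (t ^ n)⁻¹)]
  gcongr
  have := hK.dist_le_mul (t⁻¹ • z) (t⁻¹ • z')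
  rwa [Real.dist_eq, dist_eq_norm, ← smul_sub, norm_smul, Real.norm_of_nonneg (by positivity),
    inv_mul_eq_div] at this

lemma integral_dilation (φ : EuclideanSpace ℝ (Fin n) → ℝ) (ht : 0 < t) :
    ∫ z, dilation φ t z = ∫ z, φ z := by
  simp only [dilation]
  rw [integral_const_mul, Measure.integral_comp_inv_smul_of_nonneg _ _ ht.le,
    finrank_euclideanSpace, Fintype.card_fin, smul_eq_mul, ← mul_assoc,
    inv_mul_cancel₀ (by positivity), one_mul]

lemma dilation_abs (φ : EuclideanSpace ℝ (Fin n) → ℝ) (ht : 0 < t)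
    (z : EuclideanSpace ℝ (Fin n)) : dilation (fun z => |φ z|) t z = |dilation φ t z| := by
  rw [dilation, dilation, abs_mul, abs_of_pos (by positivity : 0 < (t ^ n)⁻¹)]

variable {𝕜 : Type*} [RCLike 𝕜]

lemma integrable_dilation_smul (hφ : Continuous φ) {A : ℝ} (hA : ∀ z, |φ z| ≤ A) (ht : 0 < t)
    {g : EuclideanSpace ℝ (Fin n) → 𝕜} (hg : Integrable g) (x : EuclideanSpace ℝ (Fin n)) :
    Integrable fun y => dilation φ t (x - y) • g y := by
  exact hg.bdd_smul (C := A * (t ^ n)⁻¹)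
    ((continuous_dilation hφ t).comp (by fun_prop)).aestronglyMeasurable
    (ae_of_all _ fun y => abs_dilation_le hA ht _)

/-- At scale `t` only the values of `g` on `B(x, t)` enter. -/
lemma enorm_integral_dilation_le {A : ℝ} (hA : ∀ z, |φ z| ≤ A) (hs : ∀ z, 1 < ‖z‖ → φ z = 0)
    (ht : 0 < t) (g : EuclideanSpace ℝ (Fin n) → 𝕜) (x : EuclideanSpace ℝ (Fin n)) :
    ‖∫ y, dilation φ t (x - y) • g y‖ₑ ≤
      ENNReal.ofReal A * (ENNReal.ofReal (t ^ n)⁻¹ *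
        ∫⁻ y in Metric.closedBall x t, ENNReal.ofReal ‖g y‖) := by
  have hA0 : 0 ≤ A := (abs_nonneg _).trans (hA 0)
  refine (enorm_integral_le_lintegral_enorm _).trans ?_
  rw [← mul_assoc, ← ENNReal.ofReal_mul hA0, ← lintegral_const_mul' _ _ ENNReal.ofReal_ne_top,
    ← lintegral_indicator Metric.isClosed_closedBall.measurableSet]
  refine lintegral_mono fun y => ?_
  by_cases hy : y ∈ Metric.closedBall x t
  · rw [Set.indicator_of_mem hy, ← ENNReal.ofReal_mul (by positivity), ← ofReal_norm, norm_smul]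
    gcongr
    exact abs_dilation_le hA ht _
  · have : t < ‖x - y‖ := by
      rw [← dist_eq_norm, dist_comm]
      simpa using hy
    simp [dilation_eq_zero hs ht this]

/-- At scales `t` beyond `2 ^ k / 10` the cancellation `∫ g = 0` allows the kernel `φ_t(x - y)` to be
replaced by `φ_t(x - y) - φ_t(x)`, which is small for `|y|` below `2 ^ k`. -/
lemma enorm_integral_dilation_le_of_integral_eq_zero (hφ : Continuous φ) {A : ℝ}
    (hA : ∀ z, |φ z| ≤ A) {K : ℝ≥0} (hK : LipschitzWith K φ)
    {g : EuclideanSpace ℝ (Fin n) → 𝕜} (hg : Integrable g) (hg0 : ∫ y, g y = 0)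
    (x : EuclideanSpace ℝ (Fin n)) {k : ℕ} (ht : (2 : ℝ) ^ k / 10 ≤ t) :
    ‖∫ y, dilation φ t (x - y) • g y‖ₑ ≤
      ENNReal.ofReal ((2 * A + 10 * K) * (10 ^ n * ((2 ^ k) ^ n)⁻¹)) *
        ∫⁻ y, ENNReal.ofReal (min 1 (‖y‖ / 2 ^ k)) * ENNReal.ofReal ‖g y‖ := by
  have hA0 : 0 ≤ A := (abs_nonneg _).trans (hA 0)
  have hk : (0 : ℝ) < 2 ^ k := by positivity
  have ht0 : 0 < t := lt_of_lt_of_le (by positivity) ht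
  have hsub : ∫ y, dilation φ t (x - y) • g y =
      ∫ y, (dilation φ t (x - y) - dilation φ t x) • g y := by
    simp only [sub_smul]
    have hg' : Integrable fun y => dilation φ t x • g y := hg.smul (dilation φ t x)
    rw [integral_sub (integrable_dilation_smul hφ hA ht0 hg x) hg', integral_smul, hg0,
      smul_zero, sub_zero]
  rw [hsub, ← lintegral_const_mul' _ _ ENNReal.ofReal_ne_top]
  refine (enorm_integral_le_lintegral_enorm _).trans (lintegral_mono fun y => ?_)
  rw [← mul_assoc, ← ENNReal.ofReal_mul (by positivity), ← ENNReal.ofReal_mul (by positivity),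
    ← ofReal_norm, norm_smul]
  refine ENNReal.ofReal_le_ofReal (mul_le_mul_of_nonneg_right ?_ (norm_nonneg _))
  have htn : (t ^ n)⁻¹ ≤ 10 ^ n * ((2 ^ k) ^ n)⁻¹ := by
    rw [← inv_pow, ← inv_pow, ← mul_pow]
    gcongr
    rw [inv_le_comm₀ ht0 (by positivity), mul_inv, inv_inv]
    linarith
  rw [Real.norm_eq_abs]
  have b1 : |dilation φ t (x - y) - dilation φ t x| ≤ (t ^ n)⁻¹ * (2 * A) := by
    have h1 := abs_dilation_le hA ht0 (x - y)
    have h2 := abs_dilation_le hA ht0 x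
    have h3 := abs_sub (dilation φ t (x - y)) (dilation φ t x)
    linarith
  have b2 : |dilation φ t (x - y) - dilation φ t x| ≤ (t ^ n)⁻¹ * (10 * K * (‖y‖ / 2 ^ k)) := by
    refine (abs_dilation_sub_le hK ht0 _ _).trans ?_
    have : ‖x - y - x‖ / t ≤ 10 * (‖y‖ / 2 ^ k) := by
      rw [show x - y - x = -y by abel, norm_neg, div_le_iff₀ ht0]
      calc ‖y‖ = 10 * (‖y‖ / 2 ^ k) * (2 ^ k / 10) := by field_simp
        _ ≤ _ := by gcongr
    have := mul_le_mul_of_nonneg_left this K.coe_nonneg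
    refine mul_le_mul_of_nonneg_left ?_ (by positivity)
    linarith
  have b3 : |dilation φ t (x - y) - dilation φ t x| ≤
      (t ^ n)⁻¹ * ((2 * A + 10 * K) * min 1 (‖y‖ / 2 ^ k)) := by
    have hK0 : (0 : ℝ) ≤ K := K.coe_nonneg
    rcases le_total 1 (‖y‖ / 2 ^ k) with h | h
    · rw [min_eq_left h]
      refine b1.trans (mul_le_mul_of_nonneg_left ?_ (by positivity))
      linarith
    · rw [min_eq_right h]
      refine b2.trans ?_
      gcongr
      linarith
  refine b3.trans ?_
  rw [mul_right_comm]
  rw [mul_comm]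
  gcongr

/-- The maximal function splits into a local part, and a part coming from large scales, which the
cancellation of `g` makes small. -/
lemma smoothMaximal_le (hφ : Continuous φ) {A : ℝ}
    (hA : ∀ z, |φ z| ≤ A) (hs : ∀ z, 1 < ‖z‖ → φ z = 0) {K : ℝ≥0} (hK : LipschitzWith K φ)
    {g : EuclideanSpace ℝ (Fin n) → 𝕜} (hg : Integrable g) (hg0 : ∫ y, g y = 0)
    (x : EuclideanSpace ℝ (Fin n)) :
    smoothMaximal φ g x ≤ ENNReal.ofReal A * localMaximal (fun y => ‖g y‖) x +
      ∑' k : ℕ, (Metric.closedBall (0 : EuclideanSpace ℝ (Fin n)) (2 ^ (k + 1))).indicator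
        (fun _ => ENNReal.ofReal ((2 * A + 10 * K) * (10 ^ n * ((2 ^ k) ^ n)⁻¹)) *
        ∫⁻ y, ENNReal.ofReal (min 1 (‖y‖ / 2 ^ k)) * ENNReal.ofReal ‖g y‖) x := by
  refine iSup₂_le fun t ht => ?_
  rcases le_or_gt t ((1 + ‖x‖) / 10) with h | h
  · refine le_add_right ((enorm_integral_dilation_le hA hs ht g x).trans ?_)
    gcongr
    exact le_iSup₂_of_le t ht (le_iSup_of_le h le_rfl)
  · obtain ⟨k, hk1, hk2⟩ := exists_nat_pow_near
      (by linarith [norm_nonneg x] : 1 ≤ 1 + ‖x‖) one_lt_two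
    refine le_add_left (le_trans ?_ (ENNReal.le_tsum k))
    rw [Set.indicator_of_mem (by rw [mem_closedBall_zero_iff]; linarith)]
    exact enorm_integral_dilation_le_of_integral_eq_zero hφ hA hK hg hg0 x (by linarith)

lemma lintegral_smoothMaximal_lt_top (hφ : Continuous φ) {A : ℝ}
    (hA : ∀ z, |φ z| ≤ A) (hs : ∀ z, 1 < ‖z‖ → φ z = 0) {K : ℝ≥0} (hK : LipschitzWith K φ)
    {g : EuclideanSpace ℝ (Fin n) → 𝕜} (hg : Integrable g) (hg0 : ∫ y, g y = 0)
    (hlog : Integrable fun x => ‖g x‖ * (1 + Real.posLog ‖g x‖ + Real.posLog ‖x‖)) :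
    ∫⁻ x, smoothMaximal φ g x < ⊤ := by
  have hA0 : 0 ≤ A := (abs_nonneg _).trans (hA 0)
  have hv := unitBallVolume_pos n
  set J : ℕ → ℝ≥0∞ := fun k =>
    ∫⁻ y, ENNReal.ofReal (min 1 (‖y‖ / 2 ^ k)) * ENNReal.ofReal ‖g y‖ with hJ
  set C : ℝ := (2 * A + 10 * K) * 10 ^ n * 2 ^ n * unitBallVolume n with hC
  have hnorm : AEMeasurable fun y => ENNReal.ofReal ‖g y‖ :=
    ENNReal.measurable_ofReal.comp_aemeasurable hg.1.norm.aemeasurable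
  have hmin : ∀ k : ℕ, Measurable fun y : EuclideanSpace ℝ (Fin n) =>
      ENNReal.ofReal (min 1 (‖y‖ / 2 ^ k)) := fun k =>
    ENNReal.measurable_ofReal.comp (Continuous.measurable (by fun_prop))
  have hind : ∀ k : ℕ, Measurable
      ((Metric.closedBall (0 : EuclideanSpace ℝ (Fin n)) (2 ^ (k + 1))).indicator
      (fun _ => ENNReal.ofReal ((2 * A + 10 * K) * (10 ^ n * ((2 ^ k) ^ n)⁻¹)) * J k)) :=
    fun k => measurable_const.indicator Metric.isClosed_closedBall.measurableSet
  have hfar : ∑' k : ℕ, J k < ⊤ := by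
    simp only [hJ]
    rw [← lintegral_tsum fun k => by exact (hmin k).aemeasurable.mul hnorm]
    refine lt_of_le_of_lt (lintegral_mono fun y => ?_) (hlog.const_mul 3).lintegral_lt_top
    rw [ENNReal.tsum_mul_right]
    calc _ ≤ (dyadicCount ‖y‖ + 2) * ENNReal.ofReal ‖g y‖ := by
          gcongr
          exact tsum_min_one_div_pow_two_le ‖y‖
      _ ≤ (ENNReal.ofReal (1 + 2 * Real.posLog ‖y‖) + ENNReal.ofReal 2) *
          ENNReal.ofReal ‖g y‖ := by
          gcongr
          · exact dyadicCount_le _ (norm_nonneg y)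
          · simp
      _ = ENNReal.ofReal ((1 + 2 * Real.posLog ‖y‖ + 2) * ‖g y‖) := by
          have := Real.posLog_nonneg (x := ‖y‖)
          rw [← ENNReal.ofReal_add (by positivity) (by positivity),
            ← ENNReal.ofReal_mul (by positivity)]
      _ ≤ _ := by
          refine ENNReal.ofReal_le_ofReal ?_
          have h1 := Real.posLog_nonneg (x := ‖y‖)
          have h2 := Real.posLog_nonneg (x := ‖g y‖)
          have h3 := mul_nonneg (norm_nonneg (g y)) h1
          have h4 := mul_nonneg (norm_nonneg (g y)) h2
          linarith
  calc ∫⁻ x, smoothMaximal φ g x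
      ≤ ∫⁻ x, (ENNReal.ofReal A * localMaximal (fun y => ‖g y‖) x +
        ∑' k : ℕ, (Metric.closedBall (0 : EuclideanSpace ℝ (Fin n)) (2 ^ (k + 1))).indicator
        (fun _ => ENNReal.ofReal ((2 * A + 10 * K) * (10 ^ n * ((2 ^ k) ^ n)⁻¹)) * J k) x) :=
        lintegral_mono fun x => smoothMaximal_le hφ hA hs hK hg hg0 x
    _ = ENNReal.ofReal A * (∫⁻ x, localMaximal (fun y => ‖g y‖) x) +
        ∑' k : ℕ, ENNReal.ofReal C * J k := by
        rw [lintegral_add_right _ (Measurable.tsum hind),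
          lintegral_const_mul' _ _ ENNReal.ofReal_ne_top,
          lintegral_tsum fun k => (hind k).aemeasurable]
        congr 2
        funext k
        rw [lintegral_indicator_const Metric.isClosed_closedBall.measurableSet,
          volume_closedBall_eq _ (by positivity), mul_right_comm, ← ENNReal.ofReal_mul (by positivity)]
        congr 2
        rw [hC, pow_succ, mul_pow]
        field_simp
    _ < ⊤ := by
        rw [ENNReal.tsum_mul_left]
        exact ENNReal.add_lt_top.2 ⟨ENNReal.mul_lt_top ENNReal.ofReal_lt_top
          (lintegral_localMaximal_lt_top (fun _ => norm_nonneg _) hg.1.norm.aemeasurable hlog),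
          ENNReal.mul_lt_top ENNReal.ofReal_lt_top hfar⟩

end dilation

/-- An integrable function with vanishing mean satisfying the logarithmic integrability condition
belongs to the Hardy space. -/
lemma memHardyH1_of_integral_eq_zero {𝕜 : Type*} [RCLike 𝕜] {n : ℕ}
    {g : EuclideanSpace ℝ (Fin n) → 𝕜} (hg : Integrable g) (hg0 : ∫ y, g y = 0)
    (hlog : Integrable fun x => ‖g x‖ * (1 + Real.posLog ‖g x‖ + Real.posLog ‖x‖)) :
    MemHardyH1 g := by
  let φ : ContDiffBump (0 : EuclideanSpace ℝ (Fin n)) := ⟨1 / 2, 1, by norm_num, by norm_num⟩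
  have hts : tsupport φ = Metric.closedBall 0 1 := φ.tsupport_eq
  obtain ⟨K, hK⟩ := (φ.contDiff (n := 1)).lipschitzWith_of_hasCompactSupport φ.hasCompactSupport
    one_ne_zero
  refine ⟨hg, φ, φ.contDiff, hts.le, φ.integral_pos.ne', ?_⟩
  refine lintegral_smoothMaximal_lt_top φ.continuous (A := 1) (fun z => ?_) (fun z hz => ?_) hK
    hg hg0 hlog
  · rw [abs_of_nonneg φ.nonneg]
    exact φ.le_one
  · exact φ.zero_of_le_dist (by simpa using hz.le)

/-! ### Testing a convolution against a tent -/

lemma continuous_integral_smul {𝕜 : Type*} [RCLike 𝕜] {n : ℕ} {ψ : EuclideanSpace ℝ (Fin n) → ℝ}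
    (hψ : Continuous ψ) {B : ℝ} (hB : ∀ z, |ψ z| ≤ B) {g : EuclideanSpace ℝ (Fin n) → 𝕜}
    (hg : Integrable g) : Continuous fun x => ∫ y, ψ (x - y) • g y := by
  refine continuous_of_dominated (bound := fun y => B * ‖g y‖) (fun x => ?_) (fun x => ?_)
    (hg.norm.const_mul B) (ae_of_all _ fun y => by fun_prop)
  · exact (Continuous.aestronglyMeasurable (by fun_prop)).smul hg.1
  · refine ae_of_all _ fun y => ?_
    rw [norm_smul]
    gcongr
    exact hB _

lemma measurable_smoothMaximal {𝕜 : Type*} [RCLike 𝕜] {n : ℕ} {φ : EuclideanSpace ℝ (Fin n) → ℝ}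
    (hφ : Continuous φ) {A : ℝ} (hA : ∀ z, |φ z| ≤ A) {g : EuclideanSpace ℝ (Fin n) → 𝕜}
    (hg : Integrable g) : Measurable (smoothMaximal φ g) := by
  refine LowerSemicontinuous.measurable ?_
  refine lowerSemicontinuous_biSup fun t ht => Continuous.lowerSemicontinuous ?_
  exact (continuous_integral_smul (continuous_dilation hφ t) (abs_dilation_le hA ht) hg).enorm

/-- The tent of height `2` over the ball `B(x, 2 t)`. -/
noncomputable def tent {n : ℕ} (x : EuclideanSpace ℝ (Fin n)) (t : ℝ)
    (z : EuclideanSpace ℝ (Fin n)) : ℝ :=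
  max 0 (2 - ‖z - x‖ / t)

section tent
variable {n : ℕ} {x : EuclideanSpace ℝ (Fin n)} {t : ℝ}

@[fun_prop]
lemma continuous_tent : Continuous (tent x t) := by
  unfold tent; fun_prop

lemma tent_nonneg (z : EuclideanSpace ℝ (Fin n)) : 0 ≤ tent x t z := le_max_left _ _

lemma tent_le_two (ht : 0 < t) (z : EuclideanSpace ℝ (Fin n)) : tent x t z ≤ 2 := by
  refine max_le (by norm_num) ?_
  have : 0 ≤ ‖z - x‖ / t := by positivity
  linarith

lemma tent_eq_zero (ht : 0 < t) {z : EuclideanSpace ℝ (Fin n)} (hz : 2 * t ≤ ‖z - x‖) :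
    tent x t z = 0 := by
  refine max_eq_left ?_
  have : 2 ≤ ‖z - x‖ / t := by rwa [le_div_iff₀ ht]
  linarith

lemma one_le_tent (ht : 0 < t) {z : EuclideanSpace ℝ (Fin n)} (hz : ‖z - x‖ ≤ t) :
    1 ≤ tent x t z := by
  refine le_max_of_le_right ?_
  have : ‖z - x‖ / t ≤ 1 := by rwa [div_le_one ht]
  linarith

lemma abs_tent_sub_le (ht : 0 < t) (z y : EuclideanSpace ℝ (Fin n)) :
    |tent x t z - tent x t y| ≤ ‖z - y‖ / t := by
  refine (abs_max_sub_max_le_max _ _ _ _).trans (max_le (by simp; positivity) ?_)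
  rw [show 2 - ‖z - x‖ / t - (2 - ‖y - x‖ / t) = (‖y - x‖ - ‖z - x‖) / t by ring, abs_div,
    abs_of_pos ht]
  gcongr
  refine (abs_norm_sub_norm_le _ _).trans ?_
  rw [sub_sub_sub_cancel_right, norm_sub_rev]

lemma hasCompactSupport_tent (ht : 0 < t) : HasCompactSupport (tent x t) := by
  refine HasCompactSupport.of_support_subset_isCompact (isCompact_closedBall x (2 * t)) ?_
  intro z hz
  by_contra h
  rw [Metric.mem_closedBall, dist_eq_norm, not_le] at h
  exact hz (tent_eq_zero ht h.le)

lemma integrable_tent (ht : 0 < t) : Integrable (tent x t) :=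
  continuous_tent.integrable_of_hasCompactSupport (hasCompactSupport_tent ht)

end tent

section testing
variable {n : ℕ} {ψ F : EuclideanSpace ℝ (Fin n) → ℝ}

/-- Fubini for testing a convolution against an integrable function. -/
lemma integral_mul_convolution (hψ : Continuous ψ) {B : ℝ} (hB : ∀ z, |ψ z| ≤ B)
    (hF : Integrable F) {χ : EuclideanSpace ℝ (Fin n) → ℝ} (hχ : Integrable χ) :
    ∫ z, χ z * ∫ y, ψ (z - y) * F y = ∫ y, (∫ z, χ z * ψ (z - y)) * F y := by
  have hint : Integrable (Function.uncurry fun z y => χ z * (ψ (z - y) * F y))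
      (volume.prod volume) := by
    have h1 : Integrable (fun p : EuclideanSpace ℝ (Fin n) × EuclideanSpace ℝ (Fin n) =>
      ψ (p.1 - p.2) * (χ p.1 * F p.2)) (volume.prod volume) := by
      have hc : Continuous fun p : EuclideanSpace ℝ (Fin n) × EuclideanSpace ℝ (Fin n) =>
        ψ (p.1 - p.2) := by fun_prop
      exact (hχ.mul_prod hF).bdd_mul (c := B) hc.aestronglyMeasurable (ae_of_all _ fun p => hB _)
    refine h1.congr (ae_of_all _ fun p => ?_)
    simp only [Function.uncurry]
    ring
  calc _ = ∫ z, ∫ y, χ z * (ψ (z - y) * F y) := by simp only [integral_const_mul]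
    _ = ∫ y, ∫ z, χ z * (ψ (z - y) * F y) := integral_integral_swap hint
    _ = _ := by
      refine integral_congr_ae (ae_of_all _ fun y => ?_)
      simp only
      rw [← integral_mul_const]
      simp only [mul_assoc]

/-- Averaging a tent at a scale `τ ≤ t` changes it, up to the factor `∫ ψ`, by `O(τ / t)`. -/
lemma abs_integral_tent_sub_le (hψ : Integrable ψ) {τ t : ℝ} (hτ : 0 < τ) (hτt : τ ≤ t)
    (hs : ∀ z, τ < ‖z‖ → ψ z = 0) (x y : EuclideanSpace ℝ (Fin n)) :
    |(∫ z, tent x t z * ψ (z - y)) - (∫ z, ψ z) * tent x t y| ≤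
      (Metric.closedBall x (3 * t)).indicator (fun _ => τ / t * ∫ z, |ψ z|) y := by
  have ht : 0 < t := hτ.trans_le hτt
  have hψy := hψ.comp_sub_right y
  have h1 : Integrable fun z => tent x t z * ψ (z - y) := by
    refine hψy.bdd_mul (c := 2) continuous_tent.aestronglyMeasurable (ae_of_all _ fun z => ?_)
    rw [Real.norm_of_nonneg (tent_nonneg z)]
    exact tent_le_two ht z
  have hI : (∫ z, ψ z) = ∫ z, ψ (z - y) := (integral_sub_right_eq_self ψ y).symm
  have hN : (∫ z, |ψ z|) = ∫ z, |ψ (z - y)| :=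
    (integral_sub_right_eq_self (fun z => |ψ z|) y).symm
  rw [hI, hN, mul_comm _ (tent x t y), ← integral_const_mul,
    ← integral_sub h1 (hψy.const_mul _)]
  simp only [← sub_mul]
  by_cases hy : y ∈ Metric.closedBall x (3 * t)
  · rw [Set.indicator_of_mem hy, ← integral_const_mul, ← Real.norm_eq_abs]
    refine norm_integral_le_of_norm_le (hψy.abs.const_mul _) (ae_of_all _ fun z => ?_)
    rw [Real.norm_eq_abs, abs_mul]
    by_cases hz : τ < ‖z - y‖
    · simp [hs _ hz]
    · gcongr
      refine (abs_tent_sub_le ht z y).trans ?_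
      gcongr
      exact not_lt.1 hz
  · rw [Set.indicator_of_notMem hy]
    rw [Metric.mem_closedBall, dist_eq_norm, not_le] at hy
    refine le_of_eq ?_
    rw [abs_eq_zero]
    refine integral_eq_zero_of_ae (ae_of_all _ fun z => ?_)
    by_cases hz : τ < ‖z - y‖
    · simp [hs _ hz]
    · have h3 : 2 * t ≤ ‖z - x‖ := by
        have := norm_sub_le_norm_sub_add_norm_sub y z x
        rw [norm_sub_rev y z] at this
        linarith
      simp [tent_eq_zero ht h3, tent_eq_zero ht (by linarith : 2 * t ≤ ‖y - x‖)]

/-- Testing `ψ * F` against a tent over `B(x, 2 t)` sees the mass of `F` on `B(x, t)`, up to an error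
of order `τ / t` times its mass on `B(x, 3 t)`. No sign condition is put on `ψ`. -/
lemma le_abs_integral_tent_mul (hψ : Continuous ψ) {B : ℝ} (hB : ∀ z, |ψ z| ≤ B)
    (hψi : Integrable ψ) (hF : Integrable F) (hF0 : ∀ y, 0 ≤ F y) {τ t : ℝ} (hτ : 0 < τ)
    (hτt : τ ≤ t) (hs : ∀ z, τ < ‖z‖ → ψ z = 0) (x : EuclideanSpace ℝ (Fin n)) :
    |∫ z, ψ z| * (∫ y in Metric.closedBall x t, F y) -
      τ / t * (∫ z, |ψ z|) * (∫ y in Metric.closedBall x (3 * t), F y) ≤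
      |∫ z, tent x t z * ∫ y, ψ (z - y) * F y| := by
  have ht : 0 < t := hτ.trans_le hτt
  rw [integral_mul_convolution hψ hB hF (integrable_tent ht)]
  have hmain : Integrable fun y => tent x t y * F y := by
    refine hF.bdd_mul (c := 2) continuous_tent.aestronglyMeasurable (ae_of_all _ fun z => ?_)
    rw [Real.norm_of_nonneg (tent_nonneg z)]
    exact tent_le_two ht z
  -- up to a reflection of `ψ` this is a convolution with the tent
  have hcont : Continuous fun y => ∫ z, tent x t z * ψ (z - y) := by
    have := continuous_integral_smul (𝕜 := ℝ) (ψ := fun z => ψ (-z)) (by fun_prop)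
      (fun z => hB (-z)) (integrable_tent (x := x) ht)
    simpa [mul_comm] using this
  have hin : Integrable fun y => (∫ z, tent x t z * ψ (z - y)) * F y := by
    refine hF.bdd_mul (c := (∫ z, |ψ z|) * 2 + τ / t * ∫ z, |ψ z|) hcont.aestronglyMeasurable
      (ae_of_all _ fun y => ?_)
    have h1 := abs_integral_tent_sub_le hψi hτ hτt hs x y
    have hN : 0 ≤ ∫ z, |ψ z| := integral_nonneg fun _ => abs_nonneg _
    have h2 : (Metric.closedBall x (3 * t)).indicator (fun _ => τ / t * ∫ z, |ψ z|) y ≤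
        τ / t * ∫ z, |ψ z| := Set.indicator_le_self' (fun _ _ => by positivity) y
    have h3 : |(∫ z, ψ z) * tent x t y| ≤ (∫ z, |ψ z|) * 2 := by
      rw [abs_mul, abs_of_nonneg (tent_nonneg y)]
      exact mul_le_mul abs_integral_le_integral_abs (tent_le_two ht y) (tent_nonneg y) hN
    have h4 := abs_sub_abs_le_abs_sub (∫ z, tent x t z * ψ (z - y)) ((∫ z, ψ z) * tent x t y)
    rw [Real.norm_eq_abs]
    linarith
  -- the tent is at least `1` on `B(x, t)`
  have hA : |∫ z, ψ z| * (∫ y in Metric.closedBall x t, F y) ≤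
      |(∫ z, ψ z) * ∫ y, tent x t y * F y| := by
    rw [abs_mul]
    refine mul_le_mul_of_nonneg_left (le_trans ?_ (le_abs_self _)) (abs_nonneg _)
    rw [← integral_indicator Metric.isClosed_closedBall.measurableSet]
    refine integral_mono (hF.indicator Metric.isClosed_closedBall.measurableSet) hmain fun y => ?_
    by_cases hy : y ∈ Metric.closedBall x t
    · rw [Set.indicator_of_mem hy]
      rw [Metric.mem_closedBall, dist_eq_norm] at hy
      exact le_mul_of_one_le_left (hF0 y) (one_le_tent ht hy)
    · rw [Set.indicator_of_notMem hy]
      exact mul_nonneg (tent_nonneg y) (hF0 y)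
  -- replacing the averaged tent by the tent itself costs `O(τ / t)`, on `B(x, 3 t)` only
  have hE : |(∫ y, (∫ z, tent x t z * ψ (z - y)) * F y) - (∫ z, ψ z) * ∫ y, tent x t y * F y| ≤
      τ / t * (∫ z, |ψ z|) * (∫ y in Metric.closedBall x (3 * t), F y) := by
    rw [← integral_const_mul, ← integral_sub hin (hmain.const_mul _), ← integral_const_mul,
      ← integral_indicator Metric.isClosed_closedBall.measurableSet, ← Real.norm_eq_abs]
    refine norm_integral_le_of_norm_le
      ((hF.const_mul _).indicator Metric.isClosed_closedBall.measurableSet)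
      (ae_of_all _ fun y => ?_)
    rw [← mul_assoc, ← sub_mul, norm_mul, Real.norm_of_nonneg (hF0 y), Real.norm_eq_abs]
    refine (mul_le_mul_of_nonneg_right (abs_integral_tent_sub_le hψi hτ hτt hs x y)
      (hF0 y)).trans (le_of_eq ?_)
    by_cases hy : y ∈ Metric.closedBall x (3 * t)
    · simp [Set.indicator_of_mem hy]
    · simp [Set.indicator_of_notMem hy]
  have h4 := abs_sub_abs_le_abs_sub ((∫ z, ψ z) * ∫ y, tent x t y * F y)
    (∫ y, (∫ z, tent x t z * ψ (z - y)) * F y)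
  rw [abs_sub_comm] at h4
  linarith

end testing

/-! ### Level sets of the maximal function of a nonnegative function -/

section levelSets
variable {n : ℕ} {φ F : EuclideanSpace ℝ (Fin n) → ℝ}

lemma volume_real_closedBall_eq (x : EuclideanSpace ℝ (Fin n)) {r : ℝ} (hr : 0 ≤ r) :
    volume.real (Metric.closedBall x r) = r ^ n * unitBallVolume n := by
  have := unitBallVolume_pos n
  rw [measureReal_def, volume_closedBall_eq x hr, ENNReal.toReal_ofReal (by positivity)]

lemma abs_convolution_le {ψ : EuclideanSpace ℝ (Fin n) → ℝ} {B : ℝ} (hB : ∀ z, |ψ z| ≤ B)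
    (hF : Integrable F) (hF0 : ∀ y, 0 ≤ F y) {τ t : ℝ}
    (hτt : τ ≤ t) (hs : ∀ z, τ < ‖z‖ → ψ z = 0) {x z : EuclideanSpace ℝ (Fin n)}
    (hz : z ∈ Metric.closedBall x (2 * t)) :
    |∫ y, ψ (z - y) * F y| ≤ B * ∫ y in Metric.closedBall x (3 * t), F y := by
  have hB0 : 0 ≤ B := (abs_nonneg _).trans (hB 0)
  rw [← integral_const_mul, ← integral_indicator Metric.isClosed_closedBall.measurableSet,
    ← Real.norm_eq_abs]
  refine norm_integral_le_of_norm_le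
    ((hF.const_mul _).indicator Metric.isClosed_closedBall.measurableSet) (ae_of_all _ fun y => ?_)
  rw [norm_mul, Real.norm_of_nonneg (hF0 y), Real.norm_eq_abs]
  by_cases hy : y ∈ Metric.closedBall x (3 * t)
  · rw [Set.indicator_of_mem hy]
    exact mul_le_mul_of_nonneg_right (hB _) (hF0 y)
  · rw [Set.indicator_of_notMem hy, hs, abs_zero, zero_mul]
    rw [Metric.mem_closedBall] at hy hz
    have := dist_triangle y z x
    rw [dist_comm y z, dist_eq_norm z y] at this
    linarith

/-- If the mean of `F` is of size `s` on `B(x, t)` and on `B(x, 3 t)`, then a suitable convolution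
`φ_τ * F` with `τ` proportional to `t` has size `s` on a fixed proportion of `B(x, 2 t)`, even
though `φ` may change sign. -/
lemma exists_forall_le_volume_convolution_gt (hφ : Continuous φ) {A : ℝ} (hA : ∀ z, |φ z| ≤ A)
    (hs : ∀ z, 1 < ‖z‖ → φ z = 0) (hI : ∫ z, φ z ≠ 0) :
    ∃ c > 0, ∃ C > 0, ∃ δ > 0, ∀ F : EuclideanSpace ℝ (Fin n) → ℝ, Integrable F → (∀ y, 0 ≤ F y) →
      ∀ (x : EuclideanSpace ℝ (Fin n)) (t s : ℝ), 0 < t → 0 < s →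
        s * (t ^ n * unitBallVolume n) ≤ ∫ y in Metric.closedBall x t, F y →
        ∫ y in Metric.closedBall x (3 * t), F y ≤ s * ((3 * t) ^ n * unitBallVolume n) →
        t ^ n * unitBallVolume n ≤ C * volume.real (Metric.closedBall x (2 * t) ∩
          {z | c * s < |∫ y, dilation φ (δ * t) (z - y) * F y|}) := by
  have hv := unitBallVolume_pos n
  set v := unitBallVolume n
  set I := |∫ z, φ z| with hIdef
  set N := ∫ z, |φ z| with hN
  have hI0 : 0 < I := abs_pos.2 hI
  have hIN : I ≤ N := abs_integral_le_integral_abs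
  have hN0 : 0 < N := hI0.trans_le hIN
  have hA0 : 0 ≤ A := (abs_nonneg _).trans (hA 0)
  have hφc : HasCompactSupport φ := by
    refine HasCompactSupport.of_support_subset_isCompact (isCompact_closedBall 0 1) ?_
    intro z hz
    by_contra h
    rw [mem_closedBall_zero_iff, not_le] at h
    exact hz (hs z h)
  have h3 : (1 : ℝ) ≤ 3 ^ n := one_le_pow₀ (by norm_num)
  -- with this `δ` the error term in the testing estimate is half of the main term
  set δ := I / (2 * 3 ^ n * N) with hδ
  have hδ0 : 0 < δ := by positivity
  have hδ1 : δ ≤ 1 := by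
    rw [hδ, div_le_one (by positivity)]
    nlinarith
  -- `C₁ * s` bounds the convolution on `B(x, 2 t)`
  set C₁ := A * (δ ^ n)⁻¹ * 3 ^ n * v with hC₁
  -- outside the level set the tested convolution contributes at most a quarter of the main term,
  -- and `C₁ + 1` in place of `C₁` makes the constant visibly positive
  refine ⟨I / 2 ^ (n + 3), by positivity, 8 * (C₁ + 1) / I, by positivity, δ, hδ0, ?_⟩
  intro F hF hF0 x t s ht hs0 hB1 hB3
  set Φ : EuclideanSpace ℝ (Fin n) → ℝ := fun z => ∫ y, dilation φ (δ * t) (z - y) * F y with hΦ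
  set G := Metric.closedBall x (2 * t) ∩ {z | I / 2 ^ (n + 3) * s < |Φ z|} with hG
  have hτ : 0 < δ * t := by positivity
  have hτt : δ * t ≤ t := mul_le_of_le_one_left ht.le hδ1
  have hψ := continuous_dilation hφ (δ * t)
  have hψB := abs_dilation_le hA hτ
  have hψs : ∀ z, δ * t < ‖z‖ → dilation φ (δ * t) z = 0 := fun z hz => dilation_eq_zero hs hτ hz
  have hψc : HasCompactSupport (dilation φ (δ * t)) := by
    refine HasCompactSupport.of_support_subset_isCompact (isCompact_closedBall 0 (δ * t)) ?_
    intro z hz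
    by_contra h
    rw [mem_closedBall_zero_iff, not_le] at h
    exact hz (hψs z h)
  have hΦc : Continuous Φ := continuous_integral_smul (𝕜 := ℝ) hψ hψB hF
  have hGm : MeasurableSet G := Metric.isClosed_closedBall.measurableSet.inter
    (measurableSet_lt measurable_const hΦc.abs.measurable)
  have hGfin : volume G ≠ ⊤ :=
    ((measure_mono Set.inter_subset_left).trans_lt measure_closedBall_lt_top).ne
  have hlow := le_abs_integral_tent_mul hψ hψB (hψ.integrable_of_hasCompactSupport hψc) hF hF0 hτ
    hτt hψs x
  have hNτ : ∫ z, |dilation φ (δ * t) z| = N := by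
    rw [hN, ← integral_dilation (fun z => |φ z|) hτ]
    simp only [dilation_abs φ hτ]
  rw [integral_dilation φ hτ, hNτ, ← hIdef, mul_div_assoc, div_self ht.ne', mul_one] at hlow
  have hup : ∀ z ∈ Metric.closedBall x (2 * t), |Φ z| ≤ C₁ * s := fun z hz => by
    refine (abs_convolution_le hψB hF hF0 hτt hψs hz).trans ?_
    refine (mul_le_mul_of_nonneg_left hB3 (by positivity)).trans (le_of_eq ?_)
    rw [hC₁, mul_pow, mul_pow]
    field_simp
  have hup2 : |∫ z, tent x t z * Φ z| ≤
      volume.real G * (2 * C₁ * s) + (2 * t) ^ n * v * (2 * (I / 2 ^ (n + 3) * s)) := by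
    rw [← volume_real_closedBall_eq x (by positivity : 0 ≤ 2 * t), ← smul_eq_mul (volume.real G),
      ← smul_eq_mul (volume.real _), ← integral_indicator_const _ hGm,
      ← integral_indicator_const _ Metric.isClosed_closedBall.measurableSet]
    have i1 : Integrable (G.indicator fun _ => 2 * C₁ * s) :=
      (integrable_indicator_iff hGm).2 (integrableOn_const hGfin)
    have i2 : Integrable ((Metric.closedBall x (2 * t)).indicator
        fun _ => 2 * (I / 2 ^ (n + 3) * s)) :=
      (integrable_indicator_iff Metric.isClosed_closedBall.measurableSet).2
        (integrableOn_const measure_closedBall_lt_top.ne)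
    rw [← integral_add i1 i2, ← Real.norm_eq_abs]
    refine norm_integral_le_of_norm_le (i1.add i2) (ae_of_all _ fun z => ?_)
    rw [norm_mul, Real.norm_of_nonneg (tent_nonneg z), Real.norm_eq_abs]
    by_cases hz : z ∈ Metric.closedBall x (2 * t)
    · rw [Set.indicator_of_mem hz]
      have hcs : 0 ≤ I / 2 ^ (n + 3) * s := by positivity
      by_cases hzG : z ∈ G
      · rw [Set.indicator_of_mem hzG]
        calc _ ≤ 2 * (C₁ * s) := mul_le_mul (tent_le_two ht z) (hup z hz) (abs_nonneg _) (by norm_num)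
          _ ≤ _ := by linarith
      · rw [Set.indicator_of_notMem hzG, zero_add]
        have : |Φ z| ≤ I / 2 ^ (n + 3) * s := by
          by_contra hcon
          exact hzG ⟨hz, not_le.1 hcon⟩
        exact mul_le_mul (tent_le_two ht z) this (abs_nonneg _) (by norm_num)
    · have hzt : tent x t z = 0 := by
        rw [Metric.mem_closedBall, dist_eq_norm, not_le] at hz
        exact tent_eq_zero ht hz.le
      rw [hzt, zero_mul, Set.indicator_of_notMem hz,
        Set.indicator_of_notMem fun h => hz h.1]
      simp
  have hG0 : 0 ≤ volume.real G := measureReal_nonneg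
  have e1 : I * (s * (t ^ n * v)) - δ * N * (s * ((3 * t) ^ n * v)) = I * s * t ^ n * v / 2 := by
    rw [hδ, mul_pow]
    field_simp
    ring
  have e2 : (2 * t) ^ n * v * (2 * (I / 2 ^ (n + 3) * s)) = I * s * t ^ n * v / 4 := by
    rw [mul_pow, pow_add]
    field_simp
    ring
  have h5 : I * (s * (t ^ n * v)) ≤ I * ∫ y in Metric.closedBall x t, F y := by gcongr
  have h6 : δ * N * (∫ y in Metric.closedBall x (3 * t), F y) ≤
      δ * N * (s * ((3 * t) ^ n * v)) := by gcongr
  have h7 : I * s * t ^ n * v / 4 ≤ volume.real G * (2 * C₁ * s) := by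
    rw [e2] at hup2
    linarith
  have h8 : s * (I * t ^ n * v) ≤ s * (8 * (C₁ + 1) * volume.real G) := by
    have := mul_nonneg hs0.le hG0
    nlinarith
  have h9 := le_of_mul_le_mul_left h8 hs0
  rw [div_mul_eq_mul_div, le_div_iff₀ hI0]
  linarith

/-- For almost every point where `F > s` there is a ball on which the mean of `F` exceeds `s`,
while all balls of at least twice its radius have mean at most `s`. The radius is bounded in terms
of `s`, which fails in dimension zero. -/
lemma ae_exists_stopping_radius (hn : n ≠ 0) (hF : Integrable F) (hF0 : ∀ y, 0 ≤ F y) {s : ℝ}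
    (hs : 0 < s) :
    ∃ R : ℝ, ∀ᵐ x, s < F x → ∃ t, 0 < t ∧ t ≤ R ∧
      s * (t ^ n * unitBallVolume n) ≤ ∫ y in Metric.closedBall x t, F y ∧
      ∀ r, 2 * t ≤ r → ∫ y in Metric.closedBall x r, F y ≤ s * (r ^ n * unitBallVolume n) := by
  have hv := unitBallVolume_pos n
  set v := unitBallVolume n
  set R := max 1 ((∫ y, F y) / (s * v)) with hR
  refine ⟨R, ?_⟩
  filter_upwards [IsUnifLocDoublingMeasure.ae_tendsto_average (μ := volume)
    hF.locallyIntegrable 1] with x hx hsx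
  have hlim := hx (l := nhdsWithin (0 : ℝ) (Set.Ioi 0)) (fun _ => x) id Filter.tendsto_id
    (by
      filter_upwards [self_mem_nhdsWithin] with r hr
      simpa using (Set.mem_Ioi.1 hr).le)
  -- the radius is chosen beyond half of the supremum of the radii with large mean
  set T : Set ℝ := {t | 0 < t ∧ s * (t ^ n * v) < ∫ y in Metric.closedBall x t, F y} with hT
  have hTne : T.Nonempty := by
    obtain ⟨t, ht1, ht2⟩ := ((hlim.eventually_const_lt hsx).and self_mem_nhdsWithin).exists
    have ht : 0 < t := ht2
    refine ⟨t, ht, ?_⟩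
    rw [id, setAverage_eq, volume_real_closedBall_eq x ht.le, smul_eq_mul, inv_mul_eq_div,
      lt_div_iff₀ (by positivity)] at ht1
    exact ht1
  have hTR : ∀ t ∈ T, t ≤ R := by
    rintro t ⟨ht, ht'⟩
    rcases le_or_gt t 1 with h1 | h1
    · exact h1.trans (le_max_left _ _)
    · refine le_trans ?_ (le_max_right _ _)
      rw [le_div_iff₀ (by positivity)]
      have h2 : t ≤ t ^ n := le_self_pow₀ h1.le hn
      have h3 : ∫ y in Metric.closedBall x t, F y ≤ ∫ y, F y :=
        setIntegral_le_integral hF (ae_of_all _ hF0)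
      calc t * (s * v) ≤ t ^ n * (s * v) := by gcongr
        _ = s * (t ^ n * v) := by ring
        _ ≤ _ := ht'.le.trans h3
  have hTbdd : BddAbove T := ⟨R, hTR⟩
  obtain ⟨t₀, ht₀⟩ := hTne
  have hsup : 0 < sSup T := ht₀.1.trans_le (le_csSup hTbdd ht₀)
  obtain ⟨t, ht, htlt⟩ := exists_lt_of_lt_csSup ⟨t₀, ht₀⟩ (half_lt_self hsup)
  refine ⟨t, ht.1, hTR t ht, ht.2.le, fun r hr => ?_⟩
  by_contra hcon
  have : r ∈ T := ⟨by linarith [ht.1], not_le.1 hcon⟩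
  linarith [le_csSup hTbdd this]

/-- Reverse weak-type estimate: the mass of `F` above the level `s` is controlled by the size of a
level set of any majorant of the convolutions `φ_t * F`, up to a bounded error `D`. -/
lemma exists_forall_setLIntegral_gt_le (hn : n ≠ 0) (hφ : Continuous φ) {A : ℝ}
    (hA : ∀ z, |φ z| ≤ A) (hs : ∀ z, 1 < ‖z‖ → φ z = 0) (hI : ∫ z, φ z ≠ 0)
    (hF : Integrable F) (hF0 : ∀ y, 0 ≤ F y) {D : ℝ}
    {M : EuclideanSpace ℝ (Fin n) → ℝ≥0∞}
    (hM : ∀ t, 0 < t → ∀ z, ENNReal.ofReal (|∫ y, dilation φ t (z - y) * F y| - D) ≤ M z) :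
    ∃ c > 0, ∃ C : ℝ, 0 < C ∧ ∀ s : ℝ, 0 < s → D ≤ c * s →
      ∫⁻ y, {y | s < F y}.indicator (fun y => ENNReal.ofReal (F y)) y ≤
        ENNReal.ofReal (C * s) * volume {z | ENNReal.ofReal (c * s) < M z} := by
  obtain ⟨c, hc, C, hC, δ, hδ, key⟩ := exists_forall_le_volume_convolution_gt hφ hA hs hI
  -- the other half of `c * s` absorbs the error `D`
  refine ⟨c / 2, by positivity, 10 ^ n * C, by positivity, fun s hs0 hD => ?_⟩
  obtain ⟨R, hR⟩ := ae_exists_stopping_radius hn hF hF0 hs0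
  have hv := unitBallVolume_pos n
  set S : Set (EuclideanSpace ℝ (Fin n)) := {x | s < F x ∧ ∃ t, 0 < t ∧ t ≤ R ∧
      s * (t ^ n * unitBallVolume n) ≤ ∫ y in Metric.closedBall x t, F y ∧
      ∀ r, 2 * t ≤ r → ∫ y in Metric.closedBall x r, F y ≤ s * (r ^ n * unitBallVolume n)} with hS
  set ν := volume.withDensity fun y => ENNReal.ofReal (F y) with hν
  have hch : ∀ x, ∃ t, x ∈ S → 0 < t ∧ t ≤ R ∧
      s * (t ^ n * unitBallVolume n) ≤ ∫ y in Metric.closedBall x t, F y ∧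
      ∀ r, 2 * t ≤ r → ∫ y in Metric.closedBall x r, F y ≤ s * (r ^ n * unitBallVolume n) := by
    intro x
    by_cases hx : x ∈ S
    · obtain ⟨-, t, ht⟩ := hx
      exact ⟨t, fun _ => ht⟩
    · exact ⟨0, fun h => absurd h hx⟩
  choose r hr using hch
  set V := {z | ENNReal.ofReal (c / 2 * s) < M z} with hV
  have hvit := measure_le_of_forall_closedBall_le ν (volume.restrict V) S (fun x => 2 * r x) (2 * R)
    (fun x hx => by linarith [(hr x hx).1]) (fun x hx => by linarith [(hr x hx).2.1])
    (ENNReal.ofReal (10 ^ n * C * s)) ?_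
  · have hnull : NullMeasurableSet {y | s < F y} :=
      nullMeasurableSet_lt aemeasurable_const hF.1.aemeasurable
    rw [lintegral_indicator₀ hnull, ← withDensity_apply₀ _ hnull, ← hν]
    rw [Measure.restrict_apply_univ] at hvit
    refine le_trans (measure_mono_ae ?_) hvit
    have hac : ν ≪ volume := withDensity_absolutelyContinuous _ _
    refine hac.ae_le ?_
    filter_upwards [hR] with x hx hsx
    exact ⟨hsx, hx hsx⟩
  intro x hx
  obtain ⟨h1, -, h3, h4⟩ := hr x hx
  have hvol := key F hF hF0 x (r x) s h1 hs0 h3 (h4 _ (by linarith))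
  rw [withDensity_apply _ Metric.isClosed_closedBall.measurableSet,
    Measure.restrict_apply Metric.isClosed_closedBall.measurableSet,
    ← ofReal_integral_eq_lintegral_ofReal hF.integrableOn (ae_of_all _ hF0)]
  calc ENNReal.ofReal (∫ y in Metric.closedBall x (5 * (2 * r x)), F y)
      ≤ ENNReal.ofReal (s * ((5 * (2 * r x)) ^ n * unitBallVolume n)) :=
        ENNReal.ofReal_le_ofReal (h4 _ (by linarith))
    _ = ENNReal.ofReal (10 ^ n * s * (r x ^ n * unitBallVolume n)) := by
        congr 1
        rw [← mul_assoc 5 2, mul_pow]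
        norm_num
        ring
    _ ≤ ENNReal.ofReal (10 ^ n * s * (C * volume.real (Metric.closedBall x (2 * r x) ∩
          {z | c * s < |∫ y, dilation φ (δ * r x) (z - y) * F y|}))) := by
        gcongr
    _ = ENNReal.ofReal (10 ^ n * C * s) * volume (Metric.closedBall x (2 * r x) ∩
          {z | c * s < |∫ y, dilation φ (δ * r x) (z - y) * F y|}) := by
        rw [← mul_assoc, ENNReal.ofReal_mul (by positivity), ofReal_measureReal
          ((measure_mono Set.inter_subset_left).trans_lt measure_closedBall_lt_top).ne]
        congr 2
        ring
    _ ≤ _ := by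
        gcongr
        intro z hz
        refine lt_of_lt_of_le ?_ (hM (δ * r x) (by positivity) z)
        rw [ENNReal.ofReal_lt_ofReal_iff_of_nonneg (by positivity)]
        have : c * s < |∫ y, dilation φ (δ * r x) (z - y) * F y| := hz
        linarith

/-- The reverse weak-type estimate, summed over the levels `2 ^ k * s`. -/
lemma lintegral_mul_posLog_lt_top (hn : n ≠ 0) (hφ : Continuous φ) {A : ℝ}
    (hA : ∀ z, |φ z| ≤ A) (hs : ∀ z, 1 < ‖z‖ → φ z = 0) (hI : ∫ z, φ z ≠ 0)
    (hF : Integrable F) (hF0 : ∀ y, 0 ≤ F y) {D : ℝ}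
    {M : EuclideanSpace ℝ (Fin n) → ℝ≥0∞} (hMm : Measurable M) (hMfin : ∫⁻ z, M z < ⊤)
    (hM : ∀ t, 0 < t → ∀ z, ENNReal.ofReal (|∫ y, dilation φ t (z - y) * F y| - D) ≤ M z) :
    ∫⁻ y, ENNReal.ofReal (F y * Real.posLog (F y)) < ⊤ := by
  obtain ⟨c, hc, C, hC, key⟩ := exists_forall_setLIntegral_gt_le hn hφ hA hs hI hF hF0 hM
  -- the estimate holds at all levels `2 ^ k * s` once it holds at the base level `s`
  obtain ⟨s, hs0, hsD⟩ : ∃ s : ℝ, 0 < s ∧ D ≤ c * s := by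
    refine ⟨max 1 (D / c), by positivity, ?_⟩
    rw [← div_le_iff₀' hc]
    exact le_max_right _ _
  have hcs : ENNReal.ofReal (c * s) ≠ 0 := (ENNReal.ofReal_pos.2 (by positivity)).ne'
  have hcount : ∫⁻ y, ENNReal.ofReal (F y) * dyadicCount (F y / s) < ⊤ := by
    have hpt : ∀ y, ENNReal.ofReal (F y) * dyadicCount (F y / s) =
        ∑' k : ℕ, {y | 2 ^ k * s < F y}.indicator (fun y => ENNReal.ofReal (F y)) y := by
      intro y
      rw [dyadicCount, ← ENNReal.tsum_mul_left]
      refine tsum_congr fun k => ?_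
      simp only [Set.indicator, Set.mem_ofPred_eq, lt_div_iff₀ hs0]
      split_ifs <;> simp
    have hVm : ∀ k : ℕ, MeasurableSet {z | ENNReal.ofReal (c * (2 ^ k * s)) < M z} :=
      fun k => measurableSet_lt measurable_const hMm
    calc ∫⁻ y, ENNReal.ofReal (F y) * dyadicCount (F y / s)
        = ∑' k : ℕ, ∫⁻ y, {y | 2 ^ k * s < F y}.indicator (fun y => ENNReal.ofReal (F y)) y := by
          simp only [hpt]
          refine lintegral_tsum fun k => ?_
          exact (ENNReal.measurable_ofReal.comp_aemeasurable hF.1.aemeasurable).indicator₀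
            (nullMeasurableSet_lt aemeasurable_const hF.1.aemeasurable)
      _ ≤ ∑' k : ℕ, ENNReal.ofReal (C * (2 ^ k * s)) *
            volume {z | ENNReal.ofReal (c * (2 ^ k * s)) < M z} := by
          refine ENNReal.tsum_le_tsum fun k => key _ (by positivity) (hsD.trans ?_)
          gcongr
          exact le_mul_of_one_le_left hs0.le (one_le_pow₀ (by norm_num))
      _ = ∫⁻ z, ∑' k : ℕ, {z | ENNReal.ofReal (c * (2 ^ k * s)) < M z}.indicator
            (fun _ => ENNReal.ofReal (C * (2 ^ k * s))) z := by
          rw [lintegral_tsum fun k => (measurable_const.indicator (hVm k)).aemeasurable]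
          exact tsum_congr fun k => (lintegral_indicator_const (hVm k) _).symm
      _ ≤ ∫⁻ z, ENNReal.ofReal (C * s) * (2 * (M z / ENNReal.ofReal (c * s))) := by
          refine lintegral_mono fun z => ?_
          refine le_trans (le_of_eq ?_)
            (mul_le_mul_right (tsum_pow_two_lt_le (M z / ENNReal.ofReal (c * s))) _)
          rw [← ENNReal.tsum_mul_left]
          refine tsum_congr fun k => ?_
          have : ENNReal.ofReal (2 ^ k) < M z / ENNReal.ofReal (c * s) ↔
              ENNReal.ofReal (c * (2 ^ k * s)) < M z := by
            rw [ENNReal.lt_div_iff_mul_lt (Or.inl hcs) (Or.inl ENNReal.ofReal_ne_top),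
              ← ENNReal.ofReal_mul (by positivity)]
            ring_nf
          simp only [Set.indicator, Set.mem_ofPred_eq, this]
          split_ifs
          · rw [← ENNReal.ofReal_mul (by positivity)]
            ring_nf
          · simp
      _ = ENNReal.ofReal (C * s) * (2 * ((∫⁻ z, M z) / ENNReal.ofReal (c * s))) := by
          simp only [div_eq_mul_inv]
          rw [lintegral_const_mul' _ _ ENNReal.ofReal_ne_top, lintegral_const_mul' _ _ (by simp),
            lintegral_mul_const' _ _ (ENNReal.inv_ne_top.2 hcs)]
      _ < ⊤ := ENNReal.mul_lt_top ENNReal.ofReal_lt_top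
          (ENNReal.mul_lt_top (by simp) (ENNReal.div_lt_top hMfin.ne hcs))
  refine lt_of_le_of_lt ?_ (ENNReal.add_lt_top.2 ⟨hcount,
    (hF.mul_const (Real.posLog s)).lintegral_lt_top⟩)
  have hmeas : AEMeasurable fun y => ENNReal.ofReal (F y * Real.posLog s) :=
    ENNReal.measurable_ofReal.comp_aemeasurable (hF.1.aemeasurable.mul_const _)
  rw [← lintegral_add_right' _ hmeas]
  refine lintegral_mono fun y => ?_
  have hq : 0 ≤ F y / s := div_nonneg (hF0 y) hs0.le
  calc ENNReal.ofReal (F y * Real.posLog (F y))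
      ≤ ENNReal.ofReal (F y * Real.posLog (F y / s) + F y * Real.posLog s) := by
        refine ENNReal.ofReal_le_ofReal ?_
        rw [← mul_add]
        refine mul_le_mul_of_nonneg_left ?_ (hF0 y)
        have := Real.posLog_mul (x := F y / s) (y := s)
        rwa [div_mul_cancel₀ _ hs0.ne'] at this
    _ = ENNReal.ofReal (F y) * ENNReal.ofReal (Real.posLog (F y / s)) +
        ENNReal.ofReal (F y * Real.posLog s) := by
        rw [ENNReal.ofReal_add (mul_nonneg (hF0 y) Real.posLog_nonneg)
          (mul_nonneg (hF0 y) Real.posLog_nonneg), ENNReal.ofReal_mul (hF0 y)]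
    _ ≤ _ := by
        gcongr
        exact ofReal_posLog_le_dyadicCount _ hq

end levelSets

/-! ### Decay at infinity -/

section infinity
variable {n : ℕ} {φ : EuclideanSpace ℝ (Fin n) → ℝ}

/-- Averages of `φ_t * G` over a set cost only the integral of the maximal function there. -/
lemma abs_integral_mul_setIntegral_dilation_le (hφ : Continuous φ) {A : ℝ} (hA : ∀ z, |φ z| ≤ A)
    {G : EuclideanSpace ℝ (Fin n) → ℝ} (hG : Integrable G) {t : ℝ} (ht : 0 < t)
    {B : Set (EuclideanSpace ℝ (Fin n))} (hB : MeasurableSet B) (hBfin : volume B ≠ ⊤)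
    (hM : ∫⁻ z in B, smoothMaximal φ G z ≠ ⊤) :
    |∫ y, (∫ z in B, dilation φ t (z - y)) * G y| ≤ (∫⁻ z in B, smoothMaximal φ G z).toReal := by
  have hχ : Integrable (B.indicator fun _ => (1 : ℝ)) :=
    (integrable_indicator_iff hB).2 (integrableOn_const hBfin)
  have hswap := integral_mul_convolution (continuous_dilation hφ t) (abs_dilation_le hA ht) hG hχ
  have e1 : ∀ y, ∫ z, B.indicator (fun _ => (1 : ℝ)) z * dilation φ t (z - y) =
      ∫ z in B, dilation φ t (z - y) := by
    intro y
    rw [← integral_indicator hB]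
    refine integral_congr_ae (ae_of_all _ fun z => ?_)
    by_cases hz : z ∈ B <;> simp [hz]
  simp only [e1] at hswap
  rw [← hswap, ← Real.norm_eq_abs, ← toReal_enorm]
  refine ENNReal.toReal_mono hM ((enorm_integral_le_lintegral_enorm _).trans ?_)
  rw [← lintegral_indicator hB]
  refine lintegral_mono fun z => ?_
  by_cases hz : z ∈ B
  · simp only [Set.indicator_of_mem hz, one_mul]
    exact le_iSup₂_of_le t ht le_rfl
  · simp [hz]

/-- The mass which `φ(· - y)` puts on the ball `B(x₀, r)`. -/
noncomputable def ballMass (φ : EuclideanSpace ℝ (Fin n) → ℝ) (x₀ : EuclideanSpace ℝ (Fin n))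
    (r : ℝ) (y : EuclideanSpace ℝ (Fin n)) : ℝ :=
  ∫ x in Metric.closedBall x₀ r, φ (x - y)

lemma setIntegral_dilation_eq_ballMass (φ : EuclideanSpace ℝ (Fin n) → ℝ)
    (x₀ : EuclideanSpace ℝ (Fin n)) {r t : ℝ} (hr : 0 ≤ r) (ht : 0 < t)
    (y : EuclideanSpace ℝ (Fin n)) :
    ∫ z in Metric.closedBall (t • x₀) (t * r), dilation φ t (z - y) =
      ballMass φ x₀ r (t⁻¹ • y) := by
  have h := Measure.setIntegral_comp_smul_of_pos volume (fun u => φ (t⁻¹ • (u - y)))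
    (Metric.closedBall x₀ r) ht
  rw [smul_closedBall _ _ hr, Real.norm_of_nonneg ht.le, finrank_euclideanSpace, Fintype.card_fin,
    smul_eq_mul, ← integral_const_mul] at h
  rw [ballMass]
  simp only [dilation]
  rw [← h]
  refine integral_congr_ae (ae_of_all _ fun x => ?_)
  simp only [smul_sub, smul_smul, inv_mul_cancel₀ ht.ne', one_smul]

lemma integrableOn_comp_sub_closedBall (hφ : Continuous φ) (x₀ y : EuclideanSpace ℝ (Fin n))
    (r : ℝ) : IntegrableOn (fun x => φ (x - y)) (Metric.closedBall x₀ r) :=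
  (Continuous.continuousOn (by fun_prop)).integrableOn_compact (isCompact_closedBall _ _)

lemma abs_ballMass_sub_le (hφ : Continuous φ) {K : ℝ≥0} (hK : LipschitzWith K φ)
    (x₀ : EuclideanSpace ℝ (Fin n)) (r : ℝ) (y y' : EuclideanSpace ℝ (Fin n)) :
    |ballMass φ x₀ r y - ballMass φ x₀ r y'| ≤
      K * volume.real (Metric.closedBall x₀ r) * ‖y - y'‖ := by
  rw [ballMass, ballMass, ← integral_sub (integrableOn_comp_sub_closedBall hφ _ _ _)
    (integrableOn_comp_sub_closedBall hφ _ _ _), ← Real.norm_eq_abs]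
  refine (norm_setIntegral_le_of_norm_le_const (C := K * ‖y - y'‖) measure_closedBall_lt_top
    fun x _ => ?_).trans (le_of_eq (by ring))
  have := hK.dist_le_mul (x - y) (x - y')
  rwa [dist_eq_norm, dist_eq_norm, sub_sub_sub_cancel_left, norm_sub_rev y' y] at this

lemma ballMass_eq_zero (hs : ∀ z, 1 < ‖z‖ → φ z = 0) {x₀ y : EuclideanSpace ℝ (Fin n)} {r : ℝ}
    (hy : ‖x₀‖ + r + 1 < ‖y‖) : ballMass φ x₀ r y = 0 := by
  refine setIntegral_eq_zero_of_forall_eq_zero fun x hx => hs _ ?_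
  rw [Metric.mem_closedBall, dist_eq_norm] at hx
  have h1 := norm_sub_norm_le x x₀
  have h2 := norm_sub_norm_le y x
  rw [norm_sub_rev y x] at h2
  linarith

/-- Some ball away from the origin carries a nonzero mass of `φ`. -/
lemma exists_ballMass_zero_ne_zero (hn : n ≠ 0) (hφ : Continuous φ) (hI : ∫ z, φ z ≠ 0) :
    ∃ (x₀ : EuclideanSpace ℝ (Fin n)) (r : ℝ), 0 < r ∧ 4 * r ≤ ‖x₀‖ ∧ ballMass φ x₀ r 0 ≠ 0 := by
  have : Nonempty (Fin n) := Fin.pos_iff_nonempty.1 (Nat.pos_of_ne_zero hn)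
  obtain ⟨x₀, hx0, hx⟩ : ∃ x₀ : EuclideanSpace ℝ (Fin n), x₀ ≠ 0 ∧ φ x₀ ≠ 0 := by
    by_contra! hcon
    apply hI
    refine integral_eq_zero_of_ae ?_
    have : ∀ᵐ x : EuclideanSpace ℝ (Fin n), x ≠ 0 := Measure.ae_ne volume 0
    filter_upwards [this] with x hx using hcon x hx
  obtain ⟨ε, hε, hball⟩ := Metric.continuous_iff.1 hφ x₀ (|φ x₀| / 2)
    (half_pos (abs_pos.2 hx))
  have hr : 0 < min (ε / 2) (‖x₀‖ / 4) :=
    lt_min (half_pos hε) (div_pos (norm_pos_iff.2 hx0) (by norm_num))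
  refine ⟨x₀, min (ε / 2) (‖x₀‖ / 4), hr, ?_, ?_⟩
  · linarith [min_le_right (ε / 2) (‖x₀‖ / 4)]
  set B := Metric.closedBall x₀ (min (ε / 2) (‖x₀‖ / 4)) with hB
  have hv : 0 < volume.real B := by
    have := unitBallVolume_pos n
    rw [volume_real_closedBall_eq x₀ hr.le]
    positivity
  have hconst : ∫ _ in B, φ x₀ = volume.real B * φ x₀ := by
    rw [setIntegral_const, smul_eq_mul]
  have hdiff : |ballMass φ x₀ (min (ε / 2) (‖x₀‖ / 4)) 0 - volume.real B * φ x₀| ≤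
      |φ x₀| / 2 * volume.real B := by
    rw [ballMass, ← hB, ← hconst, ← integral_sub (integrableOn_comp_sub_closedBall hφ _ _ _)
      (integrableOn_const measure_closedBall_lt_top.ne), ← Real.norm_eq_abs]
    refine norm_setIntegral_le_of_norm_le_const measure_closedBall_lt_top fun x hx => ?_
    rw [sub_zero, ← dist_eq_norm]
    refine (hball x ?_).le
    have := Metric.mem_closedBall.1 hx
    linarith [min_le_left (ε / 2) (‖x₀‖ / 4)]
  intro h0
  rw [h0, zero_sub, abs_neg, abs_mul, abs_of_pos hv] at hdiff
  have := mul_pos hv (abs_pos.2 hx)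
  linarith

/-- The dilates of a ball by powers of two are disjoint if the ball is far enough from the origin. -/
lemma sum_setLIntegral_closedBall_le (M : EuclideanSpace ℝ (Fin n) → ℝ≥0∞)
    {x₀ : EuclideanSpace ℝ (Fin n)} {r : ℝ} (hr : 0 < r) (hrx : 4 * r ≤ ‖x₀‖) (m : ℕ) :
    ∑ k ∈ Finset.range m, ∫⁻ z in Metric.closedBall ((2 : ℝ) ^ k • x₀) (2 ^ k * r), M z ≤
      ∫⁻ z, M z := by
  have hdisj : Pairwise (Function.onFun Disjoint fun k : ℕ =>
      Metric.closedBall ((2 : ℝ) ^ k • x₀) (2 ^ k * r)) := by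
    refine (pairwise_disjoint_on _).2 fun j k hjk => ?_
    refine Metric.closedBall_disjoint_closedBall ?_
    have hpow : (2 : ℝ) * 2 ^ j ≤ 2 ^ k := by
      rw [← pow_succ']
      exact pow_le_pow_right₀ (by norm_num) hjk
    have hj : (0 : ℝ) < 2 ^ j := by positivity
    rw [dist_comm, dist_eq_norm, ← sub_smul, norm_smul, Real.norm_of_nonneg (by linarith)]
    have h1 : (2 ^ k - 2 ^ j) * (4 * r) ≤ (2 ^ k - 2 ^ j) * ‖x₀‖ :=
      mul_le_mul_of_nonneg_left hrx (by linarith)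
    nlinarith
  calc _ ≤ ∑' k : ℕ, ∫⁻ z in Metric.closedBall ((2 : ℝ) ^ k • x₀) (2 ^ k * r), M z :=
        ENNReal.sum_le_tsum _
    _ = ∫⁻ z in ⋃ k : ℕ, Metric.closedBall ((2 : ℝ) ^ k • x₀) (2 ^ k * r), M z :=
        (lintegral_iUnion (fun _ => Metric.isClosed_closedBall.measurableSet) hdisj _).symm
    _ ≤ _ := setLIntegral_le_lintegral _ _

lemma integrable_ite_pow_two_lt_mul {q F : EuclideanSpace ℝ (Fin n) → ℝ} (hq : Measurable q)
    (hF : Integrable F) (k : ℕ) :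
    Integrable fun y => (if (2 : ℝ) ^ k < q y then (1 : ℝ) else 0) * F y := by
  refine (hF.indicator (measurableSet_lt (measurable_const (a := (2 : ℝ) ^ k)) hq)).congr
    (ae_of_all _ fun y => ?_)
  simp [Set.indicator, ite_mul]

lemma lintegral_mul_dyadicCount_le {q F : EuclideanSpace ℝ (Fin n) → ℝ} (hq : Measurable q)
    (hF : Integrable F) (hF0 : ∀ y, 0 ≤ F y) {C : ℝ}
    (hC : ∀ N : ℕ, ∫ y, (∑ k ∈ Finset.range N, (if (2 : ℝ) ^ k < q y then (1 : ℝ) else 0)) * F y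
      ≤ C) :
    ∫⁻ y, ENNReal.ofReal (F y) * dyadicCount (q y) ≤ ENNReal.ofReal C := by
  have hind := integrable_ite_pow_two_lt_mul hq hF
  simp only [dyadicCount, ← ENNReal.tsum_mul_left]
  have hmeasF : AEMeasurable fun y => ENNReal.ofReal (F y) :=
    ENNReal.measurable_ofReal.comp_aemeasurable hF.1.aemeasurable
  rw [lintegral_tsum fun k => by
    exact hmeasF.mul (Measurable.ite (measurableSet_lt measurable_const hq) measurable_const
      measurable_const).aemeasurable]
  refine ENNReal.tsum_le_of_sum_range_le fun N => ?_
  have hk : ∀ k : ℕ, ∫⁻ y, ENNReal.ofReal (F y) * (if (2 : ℝ) ^ k < q y then 1 else 0) =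
      ENNReal.ofReal (∫ y, (if (2 : ℝ) ^ k < q y then (1 : ℝ) else 0) * F y) := by
    intro k
    rw [ofReal_integral_eq_lintegral_ofReal (hind k) (ae_of_all _ fun y =>
      mul_nonneg (by split_ifs <;> norm_num) (hF0 y))]
    refine lintegral_congr fun y => ?_
    split_ifs <;> simp
  simp only [hk]
  rw [← ENNReal.ofReal_sum_of_nonneg fun k _ => integral_nonneg fun y =>
    mul_nonneg (by split_ifs <;> norm_num) (hF0 y), ← integral_finsetSum _ fun k _ => hind k]
  simp only [← Finset.sum_mul]
  exact ENNReal.ofReal_le_ofReal (hC N)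

/-- Logarithmic decay at infinity. The function `P = 1 - Ψ / Ψ(0)`, where `Ψ` is the mass of
`φ(· - y)` on a fixed ball, vanishes to first order at `0` and equals `1` near infinity, so that
`∑ P(y / 2 ^ k)` grows like `log |y|`; testing `F - m ϑ` against `Ψ(y / 2 ^ k)` costs
only the integral of the maximal function over one of a sequence of disjoint balls. -/
lemma lintegral_mul_dyadicCount_lt_top (hn : n ≠ 0) (hφ : Continuous φ) {A : ℝ}
    (hA : ∀ z, |φ z| ≤ A) (hs : ∀ z, 1 < ‖z‖ → φ z = 0) {K : ℝ≥0} (hK : LipschitzWith K φ)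
    (hI : ∫ z, φ z ≠ 0) {F ϑ : EuclideanSpace ℝ (Fin n) → ℝ} (hF : Integrable F)
    (hF0 : ∀ y, 0 ≤ F y) (hϑ : Integrable ϑ) (hϑ1 : ∫ y, ϑ y = 1)
    (hϑn : Integrable fun y => ‖y‖ * |ϑ y|)
    (hM : ∫⁻ z, smoothMaximal φ (fun y => F y - (∫ y, F y) * ϑ y) z < ⊤) :
    ∃ ρ > 0, ∫⁻ y, ENNReal.ofReal (F y) * dyadicCount (‖y‖ / ρ) < ⊤ := by
  obtain ⟨x₀, r, hr, hrx, hΨ0⟩ := exists_ballMass_zero_ne_zero hn hφ hI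
  set m := ∫ y, F y with hm
  have hm0 : 0 ≤ m := integral_nonneg hF0
  set G : EuclideanSpace ℝ (Fin n) → ℝ := fun y => F y - m * ϑ y with hG
  have hGint : Integrable G := hF.sub (hϑ.const_mul m)
  set Ψ := ballMass φ x₀ r with hΨ
  set ρ := ‖x₀‖ + r + 1 with hρ
  have hρ0 : 0 < ρ := by positivity
  set P : EuclideanSpace ℝ (Fin n) → ℝ := fun y => 1 - Ψ y / Ψ 0 with hP
  set L := K * volume.real (Metric.closedBall x₀ r) / |Ψ 0| with hL
  have hL0 : 0 ≤ L := by positivity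
  have hPL : ∀ y, |P y| ≤ L * ‖y‖ := by
    intro y
    have h1 := abs_ballMass_sub_le hφ hK x₀ r 0 y
    rw [zero_sub, norm_neg] at h1
    have h2 : P y = (Ψ 0 - Ψ y) / Ψ 0 := by simp only [hP]; field_simp
    rw [h2, abs_div, hL, div_mul_eq_mul_div]
    gcongr
  have hP1 : ∀ y, ρ < ‖y‖ → P y = 1 := by
    intro y hy
    simp [hP, hΨ, ballMass_eq_zero hs hy]
  have hΨc : Continuous Ψ := by
    refine (LipschitzWith.of_dist_le_mul (K := ⟨K * volume.real (Metric.closedBall x₀ r),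
      by positivity⟩) fun y y' => ?_).continuous
    rw [Real.dist_eq, dist_eq_norm]
    exact abs_ballMass_sub_le hφ hK x₀ r y y'
  have hΨb : ∀ y, |Ψ y| ≤ A * volume.real (Metric.closedBall x₀ r) := fun y => by
    rw [← Real.norm_eq_abs]
    exact norm_setIntegral_le_of_norm_le_const measure_closedBall_lt_top fun x _ => hA _
  have hPb : ∀ y, |P y| ≤ 1 + A * volume.real (Metric.closedBall x₀ r) / |Ψ 0| := by
    intro y
    refine (abs_sub _ _).trans ?_
    rw [abs_one, abs_div]
    gcongr
    exact hΨb y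
  have hPc : Continuous P := by fun_prop
  have hsc : ∀ k : ℕ, Continuous fun y : EuclideanSpace ℝ (Fin n) => ((2 : ℝ) ^ k)⁻¹ • y :=
    fun k => by fun_prop
  have hΨint : ∀ (k : ℕ) {H : EuclideanSpace ℝ (Fin n) → ℝ}, Integrable H →
      Integrable fun y => Ψ (((2 : ℝ) ^ k)⁻¹ • y) * H y := fun k H hH =>
    hH.bdd_mul (hΨc.comp (hsc k)).aestronglyMeasurable (ae_of_all _ fun y => hΨb _)
  have hPint : ∀ (k : ℕ) {H : EuclideanSpace ℝ (Fin n) → ℝ}, Integrable H →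
      Integrable fun y => P (((2 : ℝ) ^ k)⁻¹ • y) * H y := fun k H hH =>
    hH.bdd_mul (hPc.comp (hsc k)).aestronglyMeasurable (ae_of_all _ fun y => hPb _)
  set a : ℕ → ℝ := fun k =>
    (∫⁻ z in Metric.closedBall ((2 : ℝ) ^ k • x₀) (2 ^ k * r), smoothMaximal φ G z).toReal with ha
  have hafin : ∀ k : ℕ, ∫⁻ z in Metric.closedBall ((2 : ℝ) ^ k • x₀) (2 ^ k * r),
      smoothMaximal φ G z ≠ ⊤ := fun k => ((setLIntegral_le_lintegral _ _).trans_lt hM).ne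
  have hGΨ : ∀ k, |∫ y, Ψ (((2 : ℝ) ^ k)⁻¹ • y) * G y| ≤ a k := by
    intro k
    have h2k : (0 : ℝ) < 2 ^ k := by positivity
    have := abs_integral_mul_setIntegral_dilation_le hφ hA hGint h2k
      (B := Metric.closedBall ((2 : ℝ) ^ k • x₀) (2 ^ k * r))
      Metric.isClosed_closedBall.measurableSet measure_closedBall_lt_top.ne (hafin k)
    simpa only [setIntegral_dilation_eq_ballMass φ x₀ hr.le h2k] using this
  set T := ∫ y, ‖y‖ * |ϑ y| with hT
  have hT0 : 0 ≤ T := integral_nonneg fun y => by positivity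
  have hϑP : ∀ k : ℕ, |∫ y, P (((2 : ℝ) ^ k)⁻¹ • y) * ϑ y| ≤ L * T * (1 / 2) ^ k := by
    intro k
    have : L * T * (1 / 2) ^ k = ∫ y, L * (1 / 2) ^ k * (‖y‖ * |ϑ y|) := by
      rw [integral_const_mul]; ring
    rw [this, ← Real.norm_eq_abs]
    refine norm_integral_le_of_norm_le (hϑn.const_mul _) (ae_of_all _ fun y => ?_)
    rw [norm_mul, Real.norm_eq_abs, Real.norm_eq_abs, ← mul_assoc]
    gcongr
    refine (hPL _).trans (le_of_eq ?_)
    rw [norm_smul, Real.norm_of_nonneg (by positivity), one_div, inv_pow]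
    ring
  -- the identity `∫ F P_k = m ∫ ϑ P_k - ∫ G Ψ_k / Ψ(0)`
  have hFP : ∀ k : ℕ, ∫ y, P (((2 : ℝ) ^ k)⁻¹ • y) * F y ≤
      a k / |Ψ 0| + m * (L * T * (1 / 2) ^ k) := by
    intro k
    have h1 : ∀ {H : EuclideanSpace ℝ (Fin n) → ℝ}, Integrable H →
        ∫ y, P (((2 : ℝ) ^ k)⁻¹ • y) * H y =
          (∫ y, H y) - (∫ y, Ψ (((2 : ℝ) ^ k)⁻¹ • y) * H y) / Ψ 0 := by
      intro H hH
      rw [div_eq_mul_inv, ← integral_mul_const, ← integral_sub hH ((hΨint k hH).mul_const _)]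
      refine integral_congr_ae (ae_of_all _ fun y => ?_)
      simp only [hP]
      ring
    have h2 : ∫ y, Ψ (((2 : ℝ) ^ k)⁻¹ • y) * G y =
        (∫ y, Ψ (((2 : ℝ) ^ k)⁻¹ • y) * F y) - m * ∫ y, Ψ (((2 : ℝ) ^ k)⁻¹ • y) * ϑ y := by
      rw [← integral_const_mul, ← integral_sub (hΨint k hF) ((hΨint k hϑ).const_mul m)]
      refine integral_congr_ae (ae_of_all _ fun y => ?_)
      simp only [hG]
      ring
    have h3 : ∫ y, P (((2 : ℝ) ^ k)⁻¹ • y) * F y = m * (∫ y, P (((2 : ℝ) ^ k)⁻¹ • y) * ϑ y) -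
        (∫ y, Ψ (((2 : ℝ) ^ k)⁻¹ • y) * G y) / Ψ 0 := by
      rw [h1 hF, h1 hϑ, h2, hϑ1, ← hm]
      ring
    have h4 : |(∫ y, Ψ (((2 : ℝ) ^ k)⁻¹ • y) * G y) / Ψ 0| ≤ a k / |Ψ 0| := by
      rw [abs_div]
      gcongr
      exact hGΨ k
    have h5 := mul_le_mul_of_nonneg_left ((le_abs_self _).trans (hϑP k)) hm0
    have h6 := neg_le_of_abs_le h4
    linarith
  -- `P_k = 1` when `2 ^ k < |y| / ρ`, and the remaining `|P_k|` are bounded by a geometric series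
  have hcountP : ∀ y (N : ℕ), ∑ k ∈ Finset.range N, (if (2 : ℝ) ^ k < ‖y‖ / ρ then (1 : ℝ) else 0) ≤
      ∑ k ∈ Finset.range N, P (((2 : ℝ) ^ k)⁻¹ • y) + 2 * (L * ρ) := by
    intro y N
    have h1 := sum_range_div_pow_two_le_two (a := ‖y‖ / ρ) (by positivity) N
    have h2 := mul_le_mul_of_nonneg_left h1 (by positivity : 0 ≤ L * ρ)
    rw [Finset.mul_sum] at h2
    have h3 : ∑ k ∈ Finset.range N, (if (2 : ℝ) ^ k < ‖y‖ / ρ then (1 : ℝ) else 0) ≤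
        ∑ k ∈ Finset.range N, (P (((2 : ℝ) ^ k)⁻¹ • y) +
          L * ρ * (if ‖y‖ / ρ ≤ 2 ^ k then ‖y‖ / ρ / 2 ^ k else 0)) := by
      refine Finset.sum_le_sum fun k _ => ?_
      have h2k : (0 : ℝ) < 2 ^ k := by positivity
      have hnorm : ‖((2 : ℝ) ^ k)⁻¹ • y‖ = ‖y‖ / 2 ^ k := by
        rw [norm_smul, Real.norm_of_nonneg (by positivity), inv_mul_eq_div]
      rcases lt_or_ge ((2 : ℝ) ^ k) (‖y‖ / ρ) with h | h
      · rw [if_pos h, if_neg (not_le.2 h), hP1, mul_zero, add_zero]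
        rw [hnorm, lt_div_iff₀ h2k]
        rw [lt_div_iff₀ hρ0] at h
        linarith
      · rw [if_neg (not_lt.2 h), if_pos h]
        have h4 := neg_le_of_abs_le (hPL (((2 : ℝ) ^ k)⁻¹ • y))
        rw [hnorm] at h4
        have h5 : L * ρ * (‖y‖ / ρ / 2 ^ k) = L * (‖y‖ / 2 ^ k) := by field_simp
        rw [h5]
        linarith
    rw [Finset.sum_add_distrib] at h3
    linarith
  set C := (∫⁻ z, smoothMaximal φ G z).toReal / |Ψ 0| + m * (L * T * 2) + 2 * (L * ρ) * m with hC
  refine ⟨ρ, hρ0, (lintegral_mul_dyadicCount_le (q := fun y => ‖y‖ / ρ)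
    (Continuous.measurable (by fun_prop)) hF hF0 fun N => ?_).trans_lt
    (ENNReal.ofReal_lt_top (r := C))⟩
  calc ∫ y, (∑ k ∈ Finset.range N, (if (2 : ℝ) ^ k < ‖y‖ / ρ then (1 : ℝ) else 0)) * F y
      ≤ ∫ y, ((∑ k ∈ Finset.range N, P (((2 : ℝ) ^ k)⁻¹ • y) * F y) + 2 * (L * ρ) * F y) := by
        refine integral_mono ?_ ((integrable_finsetSum _ fun k _ => hPint k hF).add
          (hF.const_mul _)) fun y => ?_
        · simp only [Finset.sum_mul]
          exact integrable_finsetSum _ fun k _ => integrable_ite_pow_two_lt_mul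
            (Continuous.measurable (by fun_prop)) hF k
        · simp only
          rw [← Finset.sum_mul, ← add_mul]
          exact mul_le_mul_of_nonneg_right (hcountP y N) (hF0 y)
    _ = (∑ k ∈ Finset.range N, ∫ y, P (((2 : ℝ) ^ k)⁻¹ • y) * F y) + 2 * (L * ρ) * m := by
        rw [integral_add (integrable_finsetSum _ fun k _ => hPint k hF) (hF.const_mul _),
          integral_finsetSum _ fun k _ => hPint k hF, integral_const_mul]
    _ ≤ (∑ k ∈ Finset.range N, (a k / |Ψ 0| + m * (L * T * (1 / 2) ^ k))) + 2 * (L * ρ) * m := by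
        gcongr with k
        exact hFP k
    _ ≤ C := by
        rw [Finset.sum_add_distrib, ← Finset.sum_div, ← Finset.mul_sum, ← Finset.mul_sum, hC]
        have hsum : ∑ k ∈ Finset.range N, a k ≤ (∫⁻ z, smoothMaximal φ G z).toReal := by
          rw [ha, ← ENNReal.toReal_sum fun k _ => hafin k]
          exact ENNReal.toReal_mono hM.ne (sum_setLIntegral_closedBall_le _ hr hrx N)
        have hgeo : ∑ k ∈ Finset.range N, ((1 : ℝ) / 2) ^ k ≤ 2 := sum_geometric_two_le N
        have h1 := div_le_div_of_nonneg_right hsum (abs_nonneg (Ψ 0))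
        have h2 := mul_le_mul_of_nonneg_left
          (mul_le_mul_of_nonneg_left hgeo (mul_nonneg hL0 hT0)) hm0
        exact add_le_add (add_le_add h1 h2) le_rfl

end infinity

/-! ### The operator `T_θ` -/

lemma norm_le_sqrt_of_mem_unitCube {n : ℕ} {x : EuclideanSpace ℝ (Fin n)} (hx : x ∈ unitCube n) :
    ‖x‖ ≤ √n := by
  rw [EuclideanSpace.norm_eq]
  refine Real.sqrt_le_sqrt ?_
  calc ∑ i, ‖x i‖ ^ 2 ≤ ∑ _i : Fin n, (1 : ℝ) := by
        refine Finset.sum_le_sum fun i _ => ?_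
        have h : |x i| ≤ 1 := abs_le.2 ⟨by linarith [(hx i).1], by linarith [(hx i).2]⟩
        rw [Real.norm_eq_abs]
        exact pow_le_one₀ (abs_nonneg _) h
    _ = n := by simp

lemma posLog_le_self {a : ℝ} (ha : 0 ≤ a) : Real.posLog a ≤ a :=
  max_le ha (Real.log_le_self ha)

section cancelMean
variable {𝕜 : Type*} [RCLike 𝕜] {n : ℕ} {θ f : EuclideanSpace ℝ (Fin n) → 𝕜}

lemma integrable_cancelMean (hθ : Integrable θ) (hf : Integrable f) :
    Integrable (cancelMean θ f) := hf.sub (hθ.const_mul _)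

lemma integral_cancelMean (hθ : Integrable θ) (hθ1 : ∫ x, θ x = 1) (hf : Integrable f) :
    ∫ x, cancelMean θ f x = 0 := by
  simp only [cancelMean]
  rw [integral_sub hf (hθ.const_mul _), integral_const_mul, hθ1, mul_one, sub_self]

/-- The logarithmic integrability condition passes from `f` to `T_θ f`, since the subtracted
multiple of `θ` is bounded with bounded support. -/
lemma integrable_mul_posLog_cancelMean (hθ : Integrable θ) {C : ℝ} (hC : ∀ᵐ x, ‖θ x‖ ≤ C)
    (hθs : ∀ᵐ x, x ∉ unitCube n → θ x = 0) (hf : Integrable f)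
    (hlog : Integrable fun x => ‖f x‖ * (1 + Real.posLog ‖f x‖ + Real.posLog ‖x‖)) :
    Integrable fun x => ‖cancelMean θ f x‖ *
      (1 + Real.posLog ‖cancelMean θ f x‖ + Real.posLog ‖x‖) := by
  have hg := integrable_cancelMean hθ hf
  set m := ∫ y, f y
  set B := ‖m‖ * C
  have hmeas : AEStronglyMeasurable (fun x => ‖cancelMean θ f x‖ *
      (1 + Real.posLog ‖cancelMean θ f x‖ + Real.posLog ‖x‖)) volume := by
    have h1 := hg.1.norm
    have h2 : AEStronglyMeasurable (fun x => Real.posLog ‖cancelMean θ f x‖) volume :=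
      Real.continuous_posLog.comp_aestronglyMeasurable h1
    have h3 : AEStronglyMeasurable (fun x : EuclideanSpace ℝ (Fin n) => Real.posLog ‖x‖) volume :=
      (Real.continuous_posLog.comp continuous_norm).aestronglyMeasurable
    exact h1.mul ((aestronglyMeasurable_const.add h2).add h3)
  have hdom : Integrable fun x => (2 + Real.posLog B) *
      (‖f x‖ * (1 + Real.posLog ‖f x‖ + Real.posLog ‖x‖)) +
      (2 + Real.posLog B + Real.posLog √n) * (‖m‖ * ‖θ x‖) + B * ‖f x‖ :=
    ((hlog.const_mul _).add ((hθ.norm.const_mul _).const_mul _)).add (hf.norm.const_mul _)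
  refine hdom.mono' hmeas ?_
  filter_upwards [hC, hθs] with x hxC hxs
  set a := ‖f x‖ with ha
  set b := ‖m‖ * ‖θ x‖ with hb
  have ha0 : 0 ≤ a := norm_nonneg _
  have hb0 : 0 ≤ b := by positivity
  have hbB : b ≤ B := mul_le_mul_of_nonneg_left hxC (norm_nonneg _)
  have hab : ‖cancelMean θ f x‖ ≤ a + b := by
    rw [cancelMean, hb, ← norm_mul]
    exact norm_sub_le _ _
  have hl : Real.posLog ‖cancelMean θ f x‖ ≤ 1 + Real.posLog a + Real.posLog B := by
    have h1 := Real.posLog_le_posLog (norm_nonneg _) hab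
    have h2 := Real.posLog_add (x := a) (y := b)
    have h3 := Real.posLog_le_posLog hb0 hbB
    linarith [Real.log_two_lt_d9]
  have hbx : b * Real.posLog ‖x‖ ≤ b * Real.posLog √n := by
    by_cases hx : x ∈ unitCube n
    · exact mul_le_mul_of_nonneg_left
        (Real.posLog_le_posLog (norm_nonneg _) (norm_le_sqrt_of_mem_unitCube hx)) hb0
    · simp [hb, hxs hx]
  have p1 := Real.posLog_nonneg (x := a)
  have p2 := Real.posLog_nonneg (x := B)
  have p3 := Real.posLog_nonneg (x := ‖x‖)
  have p4 := Real.posLog_nonneg (x := ‖cancelMean θ f x‖)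
  rw [Real.norm_of_nonneg (by positivity)]
  have hba : b * Real.posLog a ≤ B * a :=
    mul_le_mul hbB (posLog_le_self ha0) p1 (hb0.trans hbB)
  calc _ ≤ (a + b) * (1 + (1 + Real.posLog a + Real.posLog B) + Real.posLog ‖x‖) := by gcongr
    _ ≤ _ := by
      have q1 := mul_nonneg ha0 p1
      have q2 := mul_nonneg ha0 p2
      have q3 := mul_nonneg ha0 p3
      have q4 := mul_nonneg p2 q1
      have q5 := mul_nonneg p2 q3
      nlinarith

end cancelMean

/-- The real form of the converse: a nonnegative `F` for which `F - (∫ F) ϑ` has an integrable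
maximal function satisfies the logarithmic integrability condition. -/
lemma integrable_mul_posLog_of_lintegral_smoothMaximal_lt_top {n : ℕ} (hn : n ≠ 0)
    {φ : EuclideanSpace ℝ (Fin n) → ℝ} (hφ : Continuous φ) {A : ℝ} (hA : ∀ z, |φ z| ≤ A)
    (hs : ∀ z, 1 < ‖z‖ → φ z = 0) {K : ℝ≥0} (hK : LipschitzWith K φ) (hφi : Integrable φ)
    (hI : ∫ z, φ z ≠ 0) {F ϑ : EuclideanSpace ℝ (Fin n) → ℝ} (hF : Integrable F)
    (hF0 : ∀ y, 0 ≤ F y) (hϑ : Integrable ϑ) (hϑ1 : ∫ y, ϑ y = 1)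
    {C : ℝ} (hC : ∀ᵐ x, |ϑ x| ≤ C) (hϑs : ∀ᵐ x, x ∉ unitCube n → ϑ x = 0)
    (hM : ∫⁻ z, smoothMaximal φ (fun y => F y - (∫ y, F y) * ϑ y) z < ⊤) :
    Integrable fun x => F x * (1 + Real.posLog (F x) + Real.posLog ‖x‖) := by
  set m := ∫ y, F y with hm
  have hm0 : 0 ≤ m := integral_nonneg hF0
  set G : EuclideanSpace ℝ (Fin n) → ℝ := fun y => F y - m * ϑ y with hG
  have hGint : Integrable G := hF.sub (hϑ.const_mul m)
  have hϑn : Integrable fun y => ‖y‖ * |ϑ y| := by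
    refine (hϑ.norm.const_mul √n).mono'
      (continuous_norm.aestronglyMeasurable.mul hϑ.1.norm) ?_
    filter_upwards [hϑs] with y hy
    rw [Real.norm_of_nonneg (by positivity), Real.norm_eq_abs]
    by_cases hyc : y ∈ unitCube n
    · gcongr
      exact norm_le_sqrt_of_mem_unitCube hyc
    · simp [hy hyc]
  obtain ⟨ρ, hρ, hdec⟩ := lintegral_mul_dyadicCount_lt_top hn hφ hA hs hK hI hF hF0 hϑ hϑ1 hϑn hM
  -- `φ_t * ϑ` is bounded uniformly in `t`
  have herr : ∀ t, 0 < t → ∀ z, ENNReal.ofReal (|∫ y, dilation φ t (z - y) * F y| -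
      m * C * ∫ z, |φ z|) ≤ smoothMaximal φ G z := by
    intro t ht z
    refine le_trans ?_ (le_iSup₂_of_le t ht le_rfl)
    rw [← ofReal_norm]
    refine ENNReal.ofReal_le_ofReal ?_
    have hiF := integrable_dilation_smul hφ hA ht hF z
    have hiϑ := integrable_dilation_smul hφ hA ht (hϑ.const_mul m) z
    have hsplit : ∫ y, dilation φ t (z - y) • G y =
        (∫ y, dilation φ t (z - y) * F y) - ∫ y, dilation φ t (z - y) • (m * ϑ y) := by
      simp only [smul_eq_mul] at hiF hiϑ ⊢
      rw [← integral_sub hiF hiϑ]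
      simp only [hG, mul_sub]
    have hdil : Integrable fun y => |dilation φ t (z - y)| := by
      have h1 : Integrable (dilation φ t) :=
        (hφi.comp_smul (inv_ne_zero ht.ne')).const_mul _
      exact (h1.comp_sub_left z).abs
    have hN : ∫ y, |dilation φ t (z - y)| = ∫ z, |φ z| := by
      rw [integral_sub_left_eq_self (fun y => |dilation φ t y|) volume z,
        ← integral_dilation (fun z => |φ z|) ht]
      simp only [dilation_abs φ ht]
    have hϑb : |∫ y, dilation φ t (z - y) • (m * ϑ y)| ≤ m * C * ∫ z, |φ z| := by
      rw [← hN, ← integral_const_mul, ← Real.norm_eq_abs]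
      refine norm_integral_le_of_norm_le (hdil.const_mul _) ?_
      filter_upwards [hC] with y hy
      rw [norm_smul, norm_mul, Real.norm_of_nonneg hm0, Real.norm_eq_abs, Real.norm_eq_abs,
        mul_comm]
      gcongr
    rw [hsplit, Real.norm_eq_abs]
    have := abs_sub_abs_le_abs_sub (∫ y, dilation φ t (z - y) * F y)
      (∫ y, dilation φ t (z - y) • (m * ϑ y))
    linarith
  have hLlog := lintegral_mul_posLog_lt_top hn hφ hA hs hI hF hF0
    (measurable_smoothMaximal hφ hA hGint) hM herr
  have hposm : AEStronglyMeasurable (fun x => Real.posLog (F x)) volume :=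
    Real.continuous_posLog.comp_aestronglyMeasurable hF.1
  have hposn : AEStronglyMeasurable (fun x : EuclideanSpace ℝ (Fin n) => Real.posLog ‖x‖) volume :=
    (Real.continuous_posLog.comp continuous_norm).aestronglyMeasurable
  have i1 : Integrable fun x => F x * Real.posLog (F x) := by
    refine ⟨hF.1.mul hposm, ?_⟩
    rw [hasFiniteIntegral_iff_ofReal (ae_of_all _ fun x => mul_nonneg (hF0 x) Real.posLog_nonneg)]
    exact hLlog
  have i2 : Integrable fun x => F x * Real.posLog (‖x‖ / ρ) := by
    refine ⟨hF.1.mul ((Real.continuous_posLog.comp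
      (continuous_norm.div_const ρ)).aestronglyMeasurable), ?_⟩
    rw [hasFiniteIntegral_iff_ofReal (ae_of_all _ fun x => mul_nonneg (hF0 x) Real.posLog_nonneg)]
    refine lt_of_le_of_lt (lintegral_mono fun x => ?_) hdec
    rw [ENNReal.ofReal_mul (hF0 x)]
    gcongr
    exact ofReal_posLog_le_dyadicCount _ (by positivity)
  refine (((hF.mul_const (1 + Real.posLog ρ)).add i1).add i2).mono'
    (hF.1.mul ((aestronglyMeasurable_const.add hposm).add hposn)) (ae_of_all _ fun x => ?_)
  have p1 := Real.posLog_nonneg (x := F x)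
  have p2 := Real.posLog_nonneg (x := ‖x‖)
  have hx := Real.posLog_mul (x := ‖x‖ / ρ) (y := ρ)
  rw [div_mul_cancel₀ _ hρ.ne'] at hx
  rw [Real.norm_of_nonneg (mul_nonneg (hF0 x) (by positivity))]
  have := mul_le_mul_of_nonneg_left hx (hF0 x)
  simp only [Pi.add_apply]
  linarith

lemma smoothMaximal_le_of_ae_eq_re {𝕜 : Type*} [RCLike 𝕜] {n : ℕ}
    {φ : EuclideanSpace ℝ (Fin n) → ℝ} (hφ : Continuous φ) {A : ℝ} (hA : ∀ z, |φ z| ≤ A)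
    {g : EuclideanSpace ℝ (Fin n) → 𝕜} (hg : Integrable g) {G : EuclideanSpace ℝ (Fin n) → ℝ}
    (hG : ∀ᵐ y, G y = RCLike.re (g y)) (x : EuclideanSpace ℝ (Fin n)) :
    smoothMaximal φ G x ≤ smoothMaximal φ g x := by
  refine iSup₂_mono fun t ht => ?_
  have h1 : ∫ y, dilation φ t (x - y) • G y = RCLike.re (∫ y, dilation φ t (x - y) • g y) := by
    rw [← integral_re (integrable_dilation_smul hφ hA ht hg x)]
    refine integral_congr_ae ?_
    filter_upwards [hG] with y hy
    rw [hy, RCLike.smul_re, smul_eq_mul]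
  rw [h1, ← ofReal_norm, ← ofReal_norm, Real.norm_eq_abs]
  exact ENNReal.ofReal_le_ofReal (RCLike.abs_re_le_norm _)

theorem mainTheorem1 {𝕜 : Type*} [RCLike 𝕜] (n : ℕ)
    (θ : EuclideanSpace ℝ (Fin n) → 𝕜)
    (hθ_meas : AEStronglyMeasurable θ volume)
    (hθ_bdd : ∃ C : ℝ, ∀ᵐ x, ‖θ x‖ ≤ C)
    (hθ_supp : ∀ᵐ x, x ∉ unitCube n → θ x = 0)
    (hθ_int : ∫ x, θ x = 1)
    (f : EuclideanSpace ℝ (Fin n) → 𝕜) (hf : Integrable f volume) :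
    (Integrable (fun x => ‖f x‖ * (1 + Real.posLog ‖f x‖ + Real.posLog ‖x‖)) volume →
      MemHardyH1 (cancelMean θ f)) ∧
    ((∀ᵐ x, 0 ≤ RCLike.re (f x) ∧ RCLike.im (f x) = 0) →
      MemHardyH1 (cancelMean θ f) →
      Integrable (fun x => ‖f x‖ * (1 + Real.posLog ‖f x‖ + Real.posLog ‖x‖)) volume) := by
  obtain ⟨C, hC⟩ := hθ_bdd
  -- a function that is not integrable would have integral `0`
  have hθ : Integrable θ := by
    by_contra h
    rw [integral_undef h] at hθ_int
    exact zero_ne_one hθ_int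
  refine ⟨fun hlog => memHardyH1_of_integral_eq_zero (integrable_cancelMean hθ hf)
    (integral_cancelMean hθ hθ_int hf)
    (integrable_mul_posLog_cancelMean hθ hC hθ_supp hf hlog), ?_⟩
  rintro hpos ⟨hg, φ, hφ, hφs, hI, hM⟩
  rcases eq_or_ne n 0 with rfl | hn
  -- the zero-dimensional space is a point
  · exact Integrable.of_finite
  have hcs : HasCompactSupport φ :=
    (isCompact_closedBall 0 1).of_isClosed_subset (isClosed_tsupport φ) hφs
  obtain ⟨A, hA⟩ := hcs.exists_bound_of_continuous hφ.continuous
  obtain ⟨K, hK⟩ := hφ.lipschitzWith_of_hasCompactSupport hcs (by simp)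
  have hs : ∀ z, 1 < ‖z‖ → φ z = 0 := fun z hz => image_eq_zero_of_notMem_tsupport fun h => by
    have := mem_closedBall_zero_iff.1 (hφs h)
    linarith
  -- passing to real parts reduces the claim to real-valued functions
  have hfn : ∀ᵐ x, f x = ((‖f x‖ : ℝ) : 𝕜) := by
    filter_upwards [hpos] with x hx
    have h1 : f x = ((RCLike.re (f x) : ℝ) : 𝕜) := by
      conv_lhs => rw [← RCLike.re_add_im (f x), hx.2]
      simp
    have h2 : ‖f x‖ = RCLike.re (f x) := by
      conv_lhs => rw [h1]
      rw [RCLike.norm_ofReal, abs_of_nonneg hx.1]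
    rw [h2]
    exact h1
  have hint : ∫ x, f x = ((∫ x, ‖f x‖ : ℝ) : 𝕜) := by
    rw [← integral_ofReal]
    exact integral_congr_ae hfn
  have hre : ∀ᵐ x, ‖f x‖ - (∫ y, ‖f y‖) * RCLike.re (θ x) = RCLike.re (cancelMean θ f x) := by
    filter_upwards [hfn] with x hx
    rw [cancelMean, hint, map_sub, RCLike.re_ofReal_mul]
    conv_rhs => rw [hx, RCLike.ofReal_re]
  refine integrable_mul_posLog_of_lintegral_smoothMaximal_lt_top hn hφ.continuous hA hs hK
    (hφ.continuous.integrable_of_hasCompactSupport hcs) hI hf.norm (fun _ => norm_nonneg _)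
    (ϑ := fun x => RCLike.re (θ x)) hθ.re ?_ (C := C) ?_ ?_ ?_
  · rw [integral_re hθ, hθ_int, RCLike.one_re]
  · filter_upwards [hC] with x hx using (RCLike.abs_re_le_norm _).trans hx
  · filter_upwards [hθ_supp] with x hx hxc
    rw [hx hxc, map_zero]
  · exact (lintegral_mono fun x =>
      smoothMaximal_le_of_ae_eq_re hφ.continuous hA hg hre x).trans_lt hM
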